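/- Let $C\subset[0,1]$ be the middle-third Cantor set and $\mathbb N=\{1,2,\dots\}$. Write $\bar 2=-2$. Every $x\in[0,1]$ has exactly one expansion $x=\sum_{n\ge1}u_n3^{-n}$ with $u_n\in\{0,2,\bar2\}$ such that the first nonzero digit (if there is one) is not $\bar 2$ and $(u_n)_{n\ge 1}$ ends neither in $2\bar2\bar2\bar2\cdots$ nor in $\bar2222\cdots$; call it the intrinsic ternary expansion of $x$. Let $\Phi=\{\phi_i\}_{i=1}^k$, $k\ge2$, be an iterated function system on $\mathbb R$ of the form $\phi_i(x)=s_i3^{-m_i}x+d_i$ with $s_i=\pm1$, $m_i\in\mathbb N$, $0\le d_i\le1$, such that $s_1=1$, $d_1=0$, $d_i>0$ for at least one $i$, and $d_i>0$ whenever $s_i=-1$. Let $F_\Phi$ be its attractor, i.e. the unique nonempty compact set with $F_\Phi=\bigcup_{i=1}^k\phi_i(F_\Phi)$. Let $a\in C$, and let $a=\sum_{n\ge1}a_n3^{-n}$ and $d_i=\sum_{n\ge1}u_{i,n}3^{-n}$ be the intrinsic ternary expansions. Put $U_\Phi(n)=(u_{1,n},\dots,u_{k,n})^T$ and $$\ell=\gcd(m_i:\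 d_i=0),\quad r=\gcd(m_1,\dots,m_k),\quad L=\Bigl(\min_i\tfrac{m_i}{r}-1\Bigr)\Bigl(\max_i\tfrac{m_i}{r}-1\Bigr),\quad D=\max_i m_i .$$ For a nonempty finite word $\mathbf x=x_1\cdots x_t$ over $\{1,\dots,k\}$ put $|\mathbf x|=t$, and let $V(\mathbf x)$ be the $t\times\infty$ matrix whose entry in row $j$ and column $p\ge1$ is $s_{x_1}\cdots s_{x_{j-1}}\,u_{x_j,\;p-(m_{x_1}+\cdots+m_{x_{j-1}})}$ if $p>m_{x_1}+\cdots+m_{x_{j-1}}$, and $0$ otherwise. Say that the pair $(p,\mathbf x)$ is matching if, after deleting all zeros from the $p$-th column of $V(\mathbf x)$ (read from top to bottom), the remaining finite (possibly empty) sequence (i) contains neither two consecutive letters $2$ nor two consecutive letters $\bar2$; and (ii) $a_p=0$ if its first letter is $2$, and $a_p=2$ if its first letter is $\bar2$. **Theorem.** Assume $r>1$. For $i=0,1,\dots,r-1$ set $n_i=\inf\{n\in\mathbb N:\ U_\Phi(rn-i)\ne(0,\dots,0)^T\}$, with $\inf\emptyset=\infty$. Then $a+F_\Phi\subseteq C$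 if and only if the following properties hold for each $i\in\{0,1,\dots,r-1\}$ with $n_i\ne\infty$: 1. the sequence $(U_\Phi(rn-i))_{n\ge n_i+L+D/r}$ is periodic with period $\ell/r$; 2. the sequence $(a_{rn-i})_{n\ge n_i+L}$ is periodic with period $\ell/r$; 3. the pair $(rp-i,\mathbf x)$ is matching for all $p\in\mathbb N$ and all nonempty finite words $\mathbf x$ over $\{1,\dots,k\}$ with $$n_i\le p<n_i+L+\frac Dr+\frac{2\ell D}{r}\quad\text{and}\quad|\mathbf x|\le p-n_i+1 .$$ Here a sequence $(b_n)_{n\ge N}$ is periodic with period $T$ if $b_{n+T}=b_n$ for all $n\ge N$ ($T$ need not be minimal). Moreover, only finitely many pairs $(p,\mathbf x)$ have to be inspected in (3): for every integer $N\ge0$ there are only finitely many pairs $(p,\mathbf x)$ with $N\le p<N+L+D/r+2\ell D/r$ and $1\le|\mathbf x|\le p-N+1$. -/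

import Mathlib

/-! ## Intrinsic ternary expansions -/

/-- `u` is the intrinsic ternary expansion of `x`. Sequences are indexed from `1`: `u n` is the
digit of `3 ^ (-n)` for `n ≥ 1`, and the unused value `u 0` is `0`. The digits are `0`, `2`, `-2`,
the first nonzero digit is not `-2`, and `u` ends neither in `2, -2, -2, …` nor in `-2, 2, 2, …`. -/
structure IsIntrinsicExpansion (x : ℝ) (u : ℕ → ℤ) : Prop where
  zero : u 0 = 0
  digit : ∀ n, u n = 0 ∨ u n = 2 ∨ u n = -2
  first_ne : ∀ n, (∀ j < n, u j = 0) → u n ≠ -2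
  not_tail : ∀ n, u n = 2 → ¬ ∀ j > n, u j = -2
  not_tail' : ∀ n, u n = -2 → ¬ ∀ j > n, u j = 2
  sum : HasSum (fun n => (u n : ℝ) * (3 : ℝ)⁻¹ ^ n) x

namespace IntrinsicExpansion

/-- The digit emitted at a rescaled remainder `y`, in `[-1, 1]`. -/
noncomputable def step (y : ℝ) : ℤ := if 1 < 3 * y then 2 else if 3 * y < -1 then -2 else 0

/-- The rescaled remainder of `x` after `n` digits. -/
noncomputable def rest (x : ℝ) : ℕ → ℝ
  | 0 => x
  | n + 1 => 3 * rest x n - step (rest x n)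

/-- The digits produced by the expansion algorithm. -/
noncomputable def digits (x : ℝ) : ℕ → ℤ
  | 0 => 0
  | n + 1 => step (rest x n)

theorem abs_rest_le {x : ℝ} (hx : |x| ≤ 1) (n : ℕ) : |rest x n| ≤ 1 := by
  induction n with
  | zero => exact hx
  | succ n ih =>
    rw [abs_le] at ih ⊢
    simp only [rest, step]
    split_ifs <;> push_cast <;> constructor <;> linarith

theorem sum_digits (x : ℝ) (n : ℕ) :
    ∑ j ∈ Finset.range (n + 1), (digits x j : ℝ) * (3 : ℝ)⁻¹ ^ j = x - rest x n * (3 : ℝ)⁻¹ ^ n := by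
  induction n with
  | zero => simp [digits, rest]
  | succ n ih =>
    rw [Finset.sum_range_succ, ih]
    simp only [digits, rest, pow_succ]
    ring

theorem hasSum_of_partial {u : ℕ → ℤ} {x : ℝ} (hu : ∀ n, u n = 0 ∨ u n = 2 ∨ u n = -2)
    {t : ℕ → ℝ} (ht : ∀ n, |t n| ≤ 1)
    (h : ∀ n, ∑ j ∈ Finset.range (n + 1), (u j : ℝ) * (3 : ℝ)⁻¹ ^ j = x - t n * (3 : ℝ)⁻¹ ^ n) :
    HasSum (fun n => (u n : ℝ) * (3 : ℝ)⁻¹ ^ n) x := by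
  have hs : Summable (fun n => (u n : ℝ) * (3 : ℝ)⁻¹ ^ n) := by
    refine Summable.of_norm_bounded (g := fun n => 2 * (3 : ℝ)⁻¹ ^ n)
      ((summable_geometric_of_lt_one (by norm_num) (by norm_num)).mul_left 2) fun n => ?_
    rw [norm_mul, norm_pow, Real.norm_eq_abs, Real.norm_eq_abs, abs_of_pos (by norm_num : (0:ℝ) < 3⁻¹)]
    refine mul_le_mul_of_nonneg_right ?_ (by positivity)
    rcases hu n with h | h | h <;> rw [h] <;> norm_num
  rw [hs.hasSum_iff_tendsto_nat, ← Filter.tendsto_add_atTop_iff_nat 1]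
  simp only [h]
  have h0 : Filter.Tendsto (fun n => t n * (3 : ℝ)⁻¹ ^ n) Filter.atTop (nhds 0) := by
    refine squeeze_zero_norm (a := fun n => (3 : ℝ)⁻¹ ^ n) (fun n => ?_)
      (tendsto_pow_atTop_nhds_zero_of_lt_one (by norm_num) (by norm_num))
    rw [norm_mul, Real.norm_eq_abs, norm_pow, Real.norm_eq_abs,
      abs_of_pos (by norm_num : (0:ℝ) < 3⁻¹)]
    exact mul_le_of_le_one_left (by positivity) (ht n)
  simpa using tendsto_const_nhds.sub h0

/-- Every point of `[0, 1]` has an intrinsic ternary expansion. -/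
theorem exists_isIntrinsicExpansion {x : ℝ} (hx : x ∈ Set.Icc (0 : ℝ) 1) :
    ∃ u, IsIntrinsicExpansion x u := by
  have hx1 : |x| ≤ 1 := by rw [abs_le]; constructor <;> linarith [hx.1, hx.2]
  have hd : ∀ n, digits x n = 0 ∨ digits x n = 2 ∨ digits x n = -2 := by
    intro n
    cases n with
    | zero => simp [digits]
    | succ n => simp only [digits, step]; split_ifs <;> simp
  refine ⟨digits x, rfl, hd, ?_, ?_, ?_, hasSum_of_partial hd (abs_rest_le hx1) (sum_digits x)⟩
  · intro n hn
    cases n with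
    | zero => simp [digits]
    | succ n =>
      have hpos : ∀ j ≤ n, 0 ≤ rest x j := by
        intro j
        induction j with
        | zero => intro _; exact hx.1
        | succ j ih =>
          intro hj
          have h1 := ih (by omega)
          have h2 := hn (j + 1) (by omega)
          simp only [digits] at h2
          simp only [rest, h2]
          push_cast
          linarith
      have := hpos n le_rfl
      simp only [digits, step]
      split_ifs <;> first | omega | linarith
  · intro n h1 h2
    cases n with
    | zero => simp [digits] at h1
    | succ n =>
      have h3 : -1 < rest x (n + 1) := by
        simp only [digits] at h1
        simp only [rest, h1]
        simp only [step] at h1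
        split_ifs at h1 with h4 <;> first | omega | (push_cast; linarith)
      have h5 : ∀ j, rest x (n + 1 + j) + 1 = 3 ^ j * (rest x (n + 1) + 1) := by
        intro j
        induction j with
        | zero => simp
        | succ j ih =>
          have h6 := h2 (n + 1 + j + 1) (by omega)
          simp only [digits] at h6
          rw [← add_assoc, pow_succ]
          simp only [rest] at ih ⊢
          rw [h6]
          push_cast
          linarith
      obtain ⟨j, hj⟩ := pow_unbounded_of_one_lt (2 / (rest x (n + 1) + 1))
        (by norm_num : (1 : ℝ) < 3)
      rw [div_lt_iff₀ (by linarith), ← h5] at hj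
      have := (abs_le.1 (abs_rest_le hx1 (n + 1 + j))).2
      linarith
  · intro n h1 h2
    cases n with
    | zero => simp [digits] at h1
    | succ n =>
      have h3 : rest x (n + 1) < 1 := by
        simp only [digits] at h1
        simp only [rest, h1]
        simp only [step] at h1
        split_ifs at h1 with h4 h5 <;> first | omega | (push_cast; linarith)
      have h5 : ∀ j, 1 - rest x (n + 1 + j) = 3 ^ j * (1 - rest x (n + 1)) := by
        intro j
        induction j with
        | zero => simp
        | succ j ih =>
          have h6 := h2 (n + 1 + j + 1) (by omega)
          simp only [digits] at h6
          rw [← add_assoc, pow_succ]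
          simp only [rest] at ih ⊢
          rw [h6]
          push_cast
          linarith
      obtain ⟨j, hj⟩ := pow_unbounded_of_one_lt (2 / (1 - rest x (n + 1)))
        (by norm_num : (1 : ℝ) < 3)
      rw [div_lt_iff₀ (by linarith), ← h5] at hj
      have := (abs_le.1 (abs_rest_le hx1 (n + 1 + j))).1
      linarith

/-- A sequence with digits in `{0, 2, -2}` whose rescaled remainder reaches `e = ± 1` is constantly
`2 e` from there on; this is the step that makes expansions unique. -/
theorem tail_of_rest {u : ℕ → ℤ} (hu : ∀ n, u n = 0 ∨ u n = 2 ∨ u n = -2) {t : ℕ → ℝ}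
    (ht : ∀ n, |t n| ≤ 1) (hrec : ∀ n, t (n + 1) = 3 * t n - u (n + 1)) {n : ℕ} {e : ℤ}
    (he : e = 1 ∨ e = -1) (hn : t n = e) : ∀ j > n, u j = 2 * e := by
  have key : ∀ j, t (n + j) = e := by
    intro j
    induction j with
    | zero => exact hn
    | succ j ih =>
      have h1 := hrec (n + j)
      have h2 := abs_le.1 (ht (n + j + 1))
      rw [← add_assoc, h1, ih]
      rw [h1, ih] at h2
      rcases he with rfl | rfl <;> rcases hu (n + j + 1) with h | h | h <;> rw [h] at h2 ⊢ <;>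
        push_cast at h2 ⊢ <;> linarith [h2.1, h2.2]
  intro j hj
  obtain ⟨i, rfl⟩ : ∃ i, j = n + i + 1 := ⟨j - n - 1, by omega⟩
  have h1 := hrec (n + i)
  have h2 := key (i + 1)
  rw [← add_assoc, h1, key i] at h2
  have : (u (n + i + 1) : ℝ) = ((2 * e : ℤ) : ℝ) := by push_cast; linarith
  exact_mod_cast this

end IntrinsicExpansion

theorem IsIntrinsicExpansion.exists_rest {x : ℝ} {u : ℕ → ℤ} (h : IsIntrinsicExpansion x u) :
    ∃ t : ℕ → ℝ, t 0 = x ∧ (∀ n, |t n| ≤ 1) ∧ ∀ n, t (n + 1) = 3 * t n - u (n + 1) := by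
  refine ⟨fun n => (x - ∑ j ∈ Finset.range (n + 1), (u j : ℝ) * (3 : ℝ)⁻¹ ^ j) * 3 ^ n, ?_, ?_, ?_⟩
  · simp [h.zero]
  · intro n
    have h1 := (hasSum_nat_add_iff' (n + 1)).2 h.sum
    have h2 : HasSum (fun j : ℕ => 2 * (3 : ℝ)⁻¹ ^ (j + (n + 1))) ((3 : ℝ)⁻¹ ^ n) := by
      have := (hasSum_geometric_of_lt_one (r := (3 : ℝ)⁻¹) (by norm_num) (by norm_num)).mul_left
        (2 * (3 : ℝ)⁻¹ ^ (n + 1))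
      have e1 : (fun j : ℕ => 2 * (3 : ℝ)⁻¹ ^ (j + (n + 1))) =
          fun j : ℕ => 2 * (3 : ℝ)⁻¹ ^ (n + 1) * (3 : ℝ)⁻¹ ^ j := by
        ext j; rw [pow_add]; ring
      have e2 : (3 : ℝ)⁻¹ ^ n = 2 * (3 : ℝ)⁻¹ ^ (n + 1) * (1 - (3 : ℝ)⁻¹)⁻¹ := by
        rw [pow_succ, show (1 - (3 : ℝ)⁻¹)⁻¹ = 3 / 2 by norm_num]; ring
      rw [e1, e2]
      exact this
    have hb : ∀ j, |(u j : ℝ)| ≤ 2 := by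
      intro j; rcases h.digit j with h | h | h <;> rw [h] <;> norm_num
    have hp : ∀ j : ℕ, (0 : ℝ) ≤ (3 : ℝ)⁻¹ ^ j := fun j => by positivity
    have hle := hasSum_le (fun j => mul_le_mul_of_nonneg_right (abs_le.1 (hb (j + (n + 1)))).2
      (hp _)) h1 h2
    have hge := hasSum_le (fun j => by
      have := mul_le_mul_of_nonneg_right (abs_le.1 (hb (j + (n + 1)))).1 (hp (j + (n + 1)))
      rwa [neg_mul] at this) h2.neg h1
    have h3 : (0 : ℝ) < 3 ^ n := by positivity
    rw [inv_pow] at hle hge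
    have e : ((3 : ℝ) ^ n)⁻¹ * 3 ^ n = 1 := inv_mul_cancel₀ h3.ne'
    rw [abs_le]
    constructor
    · have := mul_le_mul_of_nonneg_right hge h3.le
      rw [neg_mul, e] at this
      simpa using this
    · have := mul_le_mul_of_nonneg_right hle h3.le
      rw [e] at this
      simpa using this
  · intro n
    simp only
    rw [Finset.sum_range_succ _ (n + 1)]
    have h3 : ((3 : ℝ)⁻¹) ^ (n + 1) * 3 ^ (n + 1) = 1 := by
      rw [← mul_pow]; norm_num
    linear_combination (-(u (n + 1) : ℝ)) * h3

/-- Intrinsic ternary expansions are unique. -/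
theorem IsIntrinsicExpansion.unique {x : ℝ} {u v : ℕ → ℤ} (hu : IsIntrinsicExpansion x u)
    (hv : IsIntrinsicExpansion x v) : u = v := by
  obtain ⟨t, t0, tb, tr⟩ := hu.exists_rest
  obtain ⟨w, w0, wb, wr⟩ := hv.exists_rest
  have tail := @IntrinsicExpansion.tail_of_rest
  have key : ∀ n, t n = w n ∧ u n = v n := by
    intro n
    induction n with
    | zero => exact ⟨t0.trans w0.symm, hu.zero.trans hv.zero.symm⟩
    | succ n ih =>
      have h1 := tr n
      have h2 := wr n
      rw [ih.1] at h1
      have b1 := abs_le.1 (tb (n + 1))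
      have b2 := abs_le.1 (wb (n + 1))
      have hE : u (n + 1) = v (n + 1) := by
        rcases hu.digit (n + 1) with p | p | p <;> rcases hv.digit (n + 1) with q | q | q <;>
          rw [p] at h1 <;> rw [q] at h2 <;> push_cast at h1 h2
        · rw [p, q]
        · exact absurd (fun j hj => by
            simpa using tail hv.digit wb wr (n := n + 1) (e := -1) (Or.inr rfl)
              (by push_cast; linarith [b1.1, b1.2, b2.1, b2.2]) j hj)
            (hv.not_tail (n + 1) q)
        · exact absurd (fun j hj => by
            simpa using tail hv.digit wb wr (n := n + 1) (e := 1) (Or.inl rfl)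
              (by push_cast; linarith [b1.1, b1.2, b2.1, b2.2]) j hj)
            (hv.not_tail' (n + 1) q)
        · exact absurd (fun j hj => by
            simpa using tail hu.digit tb tr (n := n + 1) (e := -1) (Or.inr rfl)
              (by push_cast; linarith [b1.1, b1.2, b2.1, b2.2]) j hj)
            (hu.not_tail (n + 1) p)
        · rw [p, q]
        · linarith [b1.1, b1.2, b2.1, b2.2]
        · exact absurd (fun j hj => by
            simpa using tail hu.digit tb tr (n := n + 1) (e := 1) (Or.inl rfl)
              (by push_cast; linarith [b1.1, b1.2, b2.1, b2.2]) j hj)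
            (hu.not_tail' (n + 1) p)
        · linarith [b1.1, b1.2, b2.1, b2.2]
        · rw [p, q]
      refine ⟨?_, hE⟩
      rw [tr n, wr n, ih.1, hE]
  exact funext fun n => (key n).2

open Classical in
/-- The digits `(u_n)_{n ≥ 1}` of the intrinsic ternary expansion of `x ∈ [0, 1]`
(the zero sequence if `x ∉ [0, 1]`). -/
noncomputable def intrinsicDigits (x : ℝ) : ℕ → ℤ :=
  if h : x ∈ Set.Icc (0 : ℝ) 1 then
    (IntrinsicExpansion.exists_isIntrinsicExpansion h).choose
  else 0

theorem intrinsicDigits_spec {x : ℝ} (h : x ∈ Set.Icc (0 : ℝ) 1) :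
    IsIntrinsicExpansion x (intrinsicDigits x) := by
  rw [intrinsicDigits, dif_pos h]
  exact (IntrinsicExpansion.exists_isIntrinsicExpansion h).choose_spec

/-! ## The iterated function systems -/

/-- The class of linear iterated function systems `φ_i(x) = s_i 3^{-m_i} x + d_i`, `1 ≤ i ≤ k`,
with `k ≥ 2`, `s_i = ± 1`, `m_i ≥ 1`, `0 ≤ d_i ≤ 1`, `s_1 = 1`, `d_1 = 0`, `d_i > 0` for some `i`,
and `d_i > 0` whenever `s_i = -1`. The indices `1, …, k` are the elements `0, …, k - 1` of
`Fin k`. -/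
structure TernaryIFS (k : ℕ) where
  /-- signs -/
  s : Fin k → ℤ
  /-- exponents of the contraction ratios -/
  m : Fin k → ℕ
  /-- translations -/
  d : Fin k → ℝ
  two_le : 2 ≤ k
  sign : ∀ i, s i = 1 ∨ s i = -1
  one_le_m : ∀ i, 1 ≤ m i
  d_mem : ∀ i, d i ∈ Set.Icc (0 : ℝ) 1
  s_first : s ⟨0, by omega⟩ = 1
  d_first : d ⟨0, by omega⟩ = 0
  exists_d_pos : ∃ i, 0 < d i
  d_pos_of_neg : ∀ i, s i = -1 → 0 < d i

namespace TernaryIFS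

variable {k : ℕ} (Φ : TernaryIFS k)

/-- The map `φ_i(x) = s_i 3^{-m_i} x + d_i`. -/
noncomputable def map (i : Fin k) (x : ℝ) : ℝ := Φ.s i * (3 : ℝ)⁻¹ ^ Φ.m i * x + Φ.d i

/-- `F` is a nonempty compact set with `F = ⋃ i, φ_i(F)`. -/
structure IsAttractor (F : Set ℝ) : Prop where
  nonempty : F.Nonempty
  isCompact : IsCompact F
  eq_iUnion : F = ⋃ i, Φ.map i '' F

theorem dist_map_le (i : Fin k) (x y : ℝ) : |Φ.map i x - Φ.map i y| ≤ 3⁻¹ * |x - y| := by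
  have h1 : Φ.map i x - Φ.map i y = Φ.s i * (3 : ℝ)⁻¹ ^ Φ.m i * (x - y) := by
    simp only [map]; ring
  have h2 : |(Φ.s i : ℝ)| = 1 := by rcases Φ.sign i with h | h <;> rw [h] <;> norm_num
  rw [h1, abs_mul, abs_mul, h2, one_mul, abs_of_nonneg (by positivity)]
  refine mul_le_mul_of_nonneg_right ?_ (abs_nonneg _)
  exact pow_le_of_le_one (by norm_num) (by norm_num) (by have := Φ.one_le_m i; omega)

theorem continuous_map (i : Fin k) : Continuous (Φ.map i) := by
  unfold map; fun_prop

/-- The iterated function system has an attractor. -/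
theorem exists_isAttractor : ∃ F, Φ.IsAttractor F := by
  let S : Set ℝ := Set.range fun w : List (Fin k) => w.foldr Φ.map 0
  have h0 : (0 : ℝ) ∈ S := ⟨[], rfl⟩
  have hS : S = ⋃ i, Φ.map i '' S := by
    ext y
    simp only [Set.mem_iUnion, Set.mem_image]
    constructor
    · rintro ⟨w, rfl⟩
      cases w with
      | nil => exact ⟨⟨0, by have := Φ.two_le; omega⟩, 0, h0, by simp [map, Φ.d_first]⟩
      | cons i w => exact ⟨i, _, ⟨w, rfl⟩, rfl⟩
    · rintro ⟨i, _, ⟨w, rfl⟩, rfl⟩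
      exact ⟨i :: w, rfl⟩
  have hb : S ⊆ Set.Icc (-2) 2 := by
    rintro _ ⟨w, rfl⟩
    induction w with
    | nil => norm_num
    | cons i w ih =>
      have h1 := abs_le.1 (Φ.dist_map_le i (w.foldr Φ.map 0) 0)
      have h2 : |w.foldr Φ.map 0 - 0| ≤ 2 := by rw [sub_zero, abs_le]; exact ih
      have h3 : Φ.map i 0 = Φ.d i := by simp [map]
      have h4 := Φ.d_mem i
      rw [h3] at h1
      simp only [List.foldr_cons]
      constructor <;> linarith [h1.1, h1.2, h4.1, h4.2]
  have hc : IsCompact (closure S) :=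
    isCompact_Icc.of_isClosed_subset isClosed_closure (isClosed_Icc.closure_subset_iff.2 hb)
  refine ⟨closure S, ⟨0, subset_closure h0⟩, hc, ?_⟩
  conv_lhs => rw [hS]
  rw [closure_iUnion_of_finite]
  exact Set.iUnion_congr fun i => (image_closure_of_isCompact hc (Φ.continuous_map i).continuousOn).symm

/-- The attractor is unique. -/
theorem IsAttractor.unique {F G : Set ℝ} (hF : Φ.IsAttractor F) (hG : Φ.IsAttractor G) :
    F = G := by
  have main : ∀ {F G : Set ℝ}, Φ.IsAttractor F → Φ.IsAttractor G → F ⊆ G := by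
    intro F G hF hG
    obtain ⟨R, hR⟩ := (hF.isCompact.isBounded.union hG.isCompact.isBounded).exists_norm_le
    have key : ∀ n : ℕ, ∀ x ∈ F, ∃ y ∈ G, |x - y| ≤ (3 : ℝ)⁻¹ ^ n * (R + R) := by
      intro n
      induction n with
      | zero =>
        intro x hx
        obtain ⟨y, hy⟩ := hG.nonempty
        refine ⟨y, hy, ?_⟩
        have h1 := hR x (Or.inl hx)
        have h2 := hR y (Or.inr hy)
        have := norm_sub_le x y
        rw [Real.norm_eq_abs (x - y)] at this
        simpa using this.trans (add_le_add h1 h2)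
      | succ n ih =>
        intro x hx
        rw [hF.eq_iUnion] at hx
        obtain ⟨i, x', hx', rfl⟩ := Set.mem_iUnion.1 hx
        obtain ⟨y, hy, hxy⟩ := ih x' hx'
        refine ⟨Φ.map i y, ?_, ?_⟩
        · rw [hG.eq_iUnion]
          exact Set.mem_iUnion.2 ⟨i, y, hy, rfl⟩
        · refine (Φ.dist_map_le i x' y).trans ?_
          rw [pow_succ]
          linarith
    intro x hx
    rw [← hG.isCompact.isClosed.closure_eq, Metric.mem_closure_iff]
    intro ε hε
    have ht : Filter.Tendsto (fun n : ℕ => (3 : ℝ)⁻¹ ^ n * (R + R)) Filter.atTop (nhds 0) := by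
      simpa using (tendsto_pow_atTop_nhds_zero_of_lt_one (r := (3 : ℝ)⁻¹)
        (by norm_num) (by norm_num)).mul_const (R + R)
    obtain ⟨n, hn⟩ := (ht.eventually_lt_const hε).exists
    obtain ⟨y, hy, hxy⟩ := key n x hx
    exact ⟨y, hy, by rw [Real.dist_eq]; exact hxy.trans_lt hn⟩
  exact (main hF hG).antisymm (main hG hF)

/-- The attractor `F_Φ`. -/
noncomputable def attractor : Set ℝ := Φ.exists_isAttractor.choose

theorem isAttractor_attractor : Φ.IsAttractor Φ.attractor := Φ.exists_isAttractor.choose_spec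

/-! ## The intrinsic translation matrix and the matrices `V(x)` -/

/-- The intrinsic translation matrix: `Φ.U i n = u_{i,n}` for `n ≥ 1`. -/
noncomputable def U (i : Fin k) (n : ℕ) : ℤ := intrinsicDigits (Φ.d i) n

/-- The `n`-th column `U_Φ(n)`. -/
noncomputable def column (n : ℕ) : Fin k → ℤ := fun i => Φ.U i n

/-- The entry in row `j` and column `p ≥ 1` of `V(x)`. Rows are counted from `0`, so that `x.take j`
holds the letters before the `j`-th one: the row is `0^M u` or `0^M (-u)`, where `u` is the row of
`U_Φ` for the letter `x_j`, `M` is the sum of the exponents and the sign is the product of the signs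
over the earlier letters. -/
noncomputable def V (x : List (Fin k)) (j : Fin x.length) (p : ℕ) : ℤ :=
  if p ≤ ((x.take j).map Φ.m).sum then 0
  else ((x.take j).map Φ.s).prod * Φ.U (x.get j) (p - ((x.take j).map Φ.m).sum)

/-- The `p`-th column of `V(x)`, from top to bottom, after deleting all zero entries. -/
noncomputable def reducedColumn (x : List (Fin k)) (p : ℕ) : List ℤ :=
  (List.ofFn fun j => Φ.V x j p).filter (· ≠ 0)

/-- The two matching properties of a word `x` at column `p`, for the digit sequence `a`:
(i) the reduced column has neither two consecutive letters `2` nor two consecutive letters `-2`;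
(ii) `a_p = 0` if its first letter is `2`, and `a_p = 2` if its first letter is `-2`. -/
structure Matching (a : ℕ → ℤ) (x : List (Fin k)) (p : ℕ) : Prop where
  no_repeat : (Φ.reducedColumn x p).IsChain fun b c => ¬ (b = 2 ∧ c = 2) ∧ ¬ (b = -2 ∧ c = -2)
  head_two : (Φ.reducedColumn x p).head? = some 2 → a p = 0
  head_neg_two : (Φ.reducedColumn x p).head? = some (-2) → a p = 2

/-! ## The parameters -/

open Classical in
/-- `ℓ`, the greatest common divisor of the `m_i` with `d_i = 0`. -/
noncomputable def ell : ℕ := (Finset.univ.filter fun i => Φ.d i = 0).gcd Φ.m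

/-- `r = gcd (m_1, …, m_k)`. -/
def r : ℕ := Finset.univ.gcd Φ.m

/-- `min m_i`. -/
noncomputable def minM : ℕ := ⨅ i, Φ.m i

/-- `D = max m_i`. -/
def D : ℕ := Finset.univ.sup Φ.m

/-- `L = (min m_i / r - 1) (max m_j / r - 1)`; the divisions are exact and both factors are
nonnegative. -/
noncomputable def L : ℕ := (Φ.minM / Φ.r - 1) * (Φ.D / Φ.r - 1)

/-- `n_i = inf {n ≥ 1 : U_Φ(rn - i) ≠ 0}`, which is `⊤` if there is no such `n`. -/
noncomputable def threshold (i : ℕ) : ℕ∞ :=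
  ⨅ n ∈ {n : ℕ | 1 ≤ n ∧ Φ.column (Φ.r * n - i) ≠ 0}, (n : ℕ∞)

/-- The pairs `(p, x)`, with `x` a nonempty word, such that
`N ≤ p < N + L + D/r + 2ℓD/r` and `|x| ≤ p - N + 1`. -/
def testPairs (N : ℕ) : Set (ℕ × List (Fin k)) :=
  {q | N ≤ q.1 ∧ q.1 < N + Φ.L + Φ.D / Φ.r + 2 * Φ.ell * Φ.D / Φ.r ∧
    q.2 ≠ [] ∧ q.2.length ≤ q.1 - N + 1}

end TernaryIFS

/-- The sequence `(f n)_{n ≥ N}` is periodic with period `T` (not necessarily the least one). -/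
def PeriodicFrom {α : Type*} (f : ℕ → α) (N T : ℕ) : Prop := ∀ n ≥ N, f (n + T) = f n

/-! The points `Φ.point x` are dense in the attractor, and the column sums of `V(x)` are formal
digits of `Φ.point x`. If adding the rows of `V(x)` to `a` one at a time keeps every digit in `{0,
2}`, then `a + F ⊆ C`, since `C` is closed. Conversely, inclusion forces addition without carries: a
carry requires a constant tail in the added row, and then adding the same row delayed by `m_1` (the
first map is a pure contraction) would leave `C`; see `add_digits_of_shift` and
`image_attractor_subset_iff`. With `α p = a p - 1`, the condition says that `α p` followed by any
column has all partial sums `± 1`, which is matching.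

Reading a column downwards is a descent `(n, e) ↦ (n - m i, s i * (e + u i n))` from `(p, α p)`. It
preserves residues modulo `r`, so each class is treated separately, with the coprime exponents `m i
/ r`. If `u i N ≠ 0`, only one sign `e` keeps both `e` and `e + u i N` equal to `± 1`. Moves are
injective in `e`, so the state is also forced at `N` plus any sum of exponents, and by Schur's bound
at every `q ≥ N + L`. Hence `s j * (α (q + m j) + u j (q + m j)) = α q` there (`ReachUnit.step_eq`).
Letters with `d_j = 0` turn this into periods of `α`; solving for `u` gives periodic columns.

Conversely, periodicity carries this relation from a finite window to all `q ≥ N + L`, so only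
starts in that window need testing (`ReachUnit.of_periodicFrom`). Long words add only zero entries,
met below `N`. -/

/-! ## Digit sequences and the Cantor set -/

/-- If `∑ g_n 3^{-n} = 0` with `|g_n| ≤ 4` and the first nonzero digit `g_p` is at least `2`, then
it is `2`, and all later digits are `-4`. -/
theorem eq_neg_four_of_hasSum_zero {g : ℕ → ℤ} (hg : ∀ n, -4 ≤ g n)
    (hs : HasSum (fun n => (g n : ℝ) * (3 : ℝ)⁻¹ ^ n) 0) {p : ℕ} (h0 : ∀ n < p, g n = 0)
    (hp : 2 ≤ g p) : g p = 2 ∧ ∀ n > p, g n = -4 := by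
  have h1 := (hasSum_nat_add_iff' (p + 1)).2 hs
  have h2 : ∑ j ∈ Finset.range (p + 1), (g j : ℝ) * (3 : ℝ)⁻¹ ^ j = g p * (3 : ℝ)⁻¹ ^ p := by
    rw [Finset.sum_range_succ, Finset.sum_eq_zero, zero_add]
    intro j hj
    rw [h0 j (Finset.mem_range.1 hj)]
    simp
  rw [h2] at h1
  -- A tail of digits `-4` just cancels a digit `2` at `p`. Adding `4` to each later digit gives
  -- nonnegative terms with sum `(2 - g p) * 3⁻¹ ^ p ≤ 0`.
  have h3 : HasSum (fun j : ℕ => 4 * (3 : ℝ)⁻¹ ^ (j + (p + 1))) (2 * (3 : ℝ)⁻¹ ^ p) := by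
    have := (hasSum_geometric_of_lt_one (r := (3 : ℝ)⁻¹) (by norm_num) (by norm_num)).mul_left
      (4 * (3 : ℝ)⁻¹ ^ (p + 1))
    have e1 : (fun j : ℕ => 4 * (3 : ℝ)⁻¹ ^ (j + (p + 1))) =
        fun j : ℕ => 4 * (3 : ℝ)⁻¹ ^ (p + 1) * (3 : ℝ)⁻¹ ^ j := by
      ext j; rw [pow_add]; ring
    have e2 : 2 * (3 : ℝ)⁻¹ ^ p = 4 * (3 : ℝ)⁻¹ ^ (p + 1) * (1 - (3 : ℝ)⁻¹)⁻¹ := by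
      rw [pow_succ, show (1 - (3 : ℝ)⁻¹)⁻¹ = 3 / 2 by norm_num]; ring
    rw [e1, e2]
    exact this
  have h4 := h1.add h3
  have h5 : (0 : ℝ) < (3 : ℝ)⁻¹ ^ p := by positivity
  have hnn : ∀ j, 0 ≤ (g (j + (p + 1)) : ℝ) * (3 : ℝ)⁻¹ ^ (j + (p + 1)) +
      4 * (3 : ℝ)⁻¹ ^ (j + (p + 1)) := by
    intro j
    have : (-4 : ℝ) ≤ g (j + (p + 1)) := by exact_mod_cast hg (j + (p + 1))
    have h6 : (0 : ℝ) < (3 : ℝ)⁻¹ ^ (j + (p + 1)) := by positivity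
    nlinarith
  have h7 := h4.nonneg hnn
  have h8 : (g p : ℝ) ≤ 2 := by
    by_contra hc
    nlinarith
  have h9 : g p = 2 := le_antisymm (by exact_mod_cast h8) hp
  refine ⟨h9, fun n hn => ?_⟩
  rw [h9, show (0 : ℝ) - ((2 : ℤ) : ℝ) * (3 : ℝ)⁻¹ ^ p + 2 * (3 : ℝ)⁻¹ ^ p = 0 by push_cast; ring,
    hasSum_zero_iff_of_nonneg hnn] at h4
  obtain ⟨j, rfl⟩ : ∃ j, n = j + (p + 1) := ⟨n - (p + 1), by omega⟩
  have h10 := congrFun h4 j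
  have h11 : (0 : ℝ) < (3 : ℝ)⁻¹ ^ (j + (p + 1)) := by positivity
  have h12 : ((g (j + (p + 1)) : ℝ) + 4) * (3 : ℝ)⁻¹ ^ (j + (p + 1)) = 0 := by
    rw [add_mul]; exact h10
  have h13 : (g (j + (p + 1)) : ℝ) + 4 = 0 := by
    rcases mul_eq_zero.1 h12 with h | h
    · exact h
    · exact absurd h h11.ne'
  have : (g (j + (p + 1)) : ℝ) = ((-4 : ℤ) : ℝ) := by push_cast; linarith
  exact_mod_cast this

/-- Two expansions with digits `0, 2, -2` of the same number, the first of which does not end in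
`2, -2, -2, …` or `-2, 2, 2, …`, are equal, or they end in `0, 2, 2, …` and `2, -2, -2, …`, up to
a common sign. -/
theorem eq_or_tail_of_hasSum {v w : ℕ → ℤ} {x : ℝ} (hv : ∀ n, v n = 0 ∨ v n = 2 ∨ v n = -2)
    (hw : ∀ n, w n = 0 ∨ w n = 2 ∨ w n = -2)
    (hv1 : ∀ n, v n = 2 → ¬ ∀ j > n, v j = -2) (hv2 : ∀ n, v n = -2 → ¬ ∀ j > n, v j = 2)
    (sv : HasSum (fun n => (v n : ℝ) * (3 : ℝ)⁻¹ ^ n) x)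
    (sw : HasSum (fun n => (w n : ℝ) * (3 : ℝ)⁻¹ ^ n) x) :
    v = w ∨ ∃ p, ∃ e : ℤ, (e = 2 ∨ e = -2) ∧ v p = 0 ∧ w p = e ∧ ∀ n > p, v n = e ∧ w n = -e := by
  by_cases hvw : v = w
  · exact Or.inl hvw
  right
  have hne : ∃ n, v n ≠ w n := Function.ne_iff.1 hvw
  classical
  have hp := Nat.find_spec hne
  have hlt : ∀ n < Nat.find hne, v n = w n := fun n hn => not_not.1 (Nat.find_min hne hn)
  generalize Nat.find hne = p at hp hlt
  have hs : HasSum (fun n => ((v n - w n : ℤ) : ℝ) * (3 : ℝ)⁻¹ ^ n) 0 := by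
    have := sv.sub sw
    rw [sub_self] at this
    simpa only [Int.cast_sub, sub_mul] using this
  have hs' : HasSum (fun n => ((w n - v n : ℤ) : ℝ) * (3 : ℝ)⁻¹ ^ n) 0 := by
    have := sw.sub sv
    rw [sub_self] at this
    simpa only [Int.cast_sub, sub_mul] using this
  have hb : ∀ n, -4 ≤ v n - w n := fun n => by have := hv n; have := hw n; omega
  have hb' : ∀ n, -4 ≤ w n - v n := fun n => by have := hv n; have := hw n; omega
  have hvp := hv p
  have hwp := hw p
  -- The digits are even, so at the first discrepancy they differ by at least `2`. The excluded
  -- tails of `v` leave only `v p = 0`.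
  rcases lt_or_gt_of_ne hp with hlt' | hgt'
  · obtain ⟨h1, h2⟩ := eq_neg_four_of_hasSum_zero hb' hs' (p := p)
      (fun n hn => by rw [hlt n hn, sub_self]) (by omega)
    have h3 : ∀ n > p, v n = 2 ∧ w n = -2 := fun n hn => by
      have := h2 n hn; have := hv n; have := hw n; omega
    have h4 : v p ≠ -2 := fun h => hv2 p h fun j hj => (h3 j hj).1
    exact ⟨p, 2, Or.inl rfl, by omega, by omega, h3⟩
  · obtain ⟨h1, h2⟩ := eq_neg_four_of_hasSum_zero hb hs (p := p)
      (fun n hn => by rw [hlt n hn, sub_self]) (by omega)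
    have h3 : ∀ n > p, v n = -2 ∧ w n = 2 := fun n hn => by
      have := h2 n hn; have := hv n; have := hw n; omega
    have h4 : v p ≠ 2 := fun h => hv1 p h fun j hj => (h3 j hj).1
    exact ⟨p, -2, Or.inr rfl, by omega, by omega, by simpa using h3⟩

/-- Adding `v` to `b` digit by digit: if `b`, `b + v` and `b + 3^{-m} v` have expansions with
digits `0, 2`, for some `m ≥ 1`, then no carries occur in `b + v`. -/
theorem add_digits_of_shift {b c c' v : ℕ → ℤ} {x y : ℝ} {m : ℕ} (hm : 1 ≤ m)
    (hb : ∀ n, b n = 0 ∨ b n = 2) (hc : ∀ n, c n = 0 ∨ c n = 2) (hc' : ∀ n, c' n = 0 ∨ c' n = 2)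
    (hv : ∀ n, v n = 0 ∨ v n = 2 ∨ v n = -2)
    (hv1 : ∀ n, v n = 2 → ¬ ∀ j > n, v j = -2) (hv2 : ∀ n, v n = -2 → ¬ ∀ j > n, v j = 2)
    (sb : HasSum (fun n => (b n : ℝ) * (3 : ℝ)⁻¹ ^ n) x)
    (sv : HasSum (fun n => (v n : ℝ) * (3 : ℝ)⁻¹ ^ n) y)
    (sc : HasSum (fun n => (c n : ℝ) * (3 : ℝ)⁻¹ ^ n) (x + y))
    (sv' : HasSum (fun n => (v (n - m) : ℝ) * (3 : ℝ)⁻¹ ^ n) ((3 : ℝ)⁻¹ ^ m * y))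
    (sc' : HasSum (fun n => (c' n : ℝ) * (3 : ℝ)⁻¹ ^ n) (x + (3 : ℝ)⁻¹ ^ m * y)) (n : ℕ) :
    c n = b n + v n := by
  have sw : HasSum (fun n => ((c n - b n : ℤ) : ℝ) * (3 : ℝ)⁻¹ ^ n) y := by
    have := sc.sub sb
    rw [add_sub_cancel_left] at this
    simpa only [Int.cast_sub, sub_mul] using this
  have sw' : HasSum (fun n => ((c' n - b n : ℤ) : ℝ) * (3 : ℝ)⁻¹ ^ n) ((3 : ℝ)⁻¹ ^ m * y) := by
    have := sc'.sub sb
    rw [add_sub_cancel_left] at this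
    simpa only [Int.cast_sub, sub_mul] using this
  rcases eq_or_tail_of_hasSum hv (fun n => by have := hc n; have := hb n; omega) hv1 hv2 sv sw with
    h | ⟨p, e, he, h1, h2, h3⟩
  · have := congrFun h n
    omega
  exfalso
  -- A carry makes `c - b` equal to `-e` after `p`, so `b` is constant there: `2` if `e = 2`, `0` if
  -- `e = -2`.
  have hb3 : ∀ n > p, 2 * b n = 2 + e := fun n hn => by
    have := h3 n hn; have := hc n; have := hb n; omega
  have hshift1 : ∀ n, v (n - m) = 2 → ¬ ∀ j > n, v (j - m) = -2 := by
    intro n hn hj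
    refine hv1 _ hn fun j hj' => ?_
    have := hj (j + m) (by omega)
    simpa using this
  have hshift2 : ∀ n, v (n - m) = -2 → ¬ ∀ j > n, v (j - m) = 2 := by
    intro n hn hj
    refine hv2 _ hn fun j hj' => ?_
    have := hj (j + m) (by omega)
    simpa using this
  rcases eq_or_tail_of_hasSum (fun n => hv (n - m))
    (fun n => by have := hc' n; have := hb n; omega) hshift1 hshift2 sv' sw' with
    h | ⟨q, f, hf, k1, k2, k3⟩
  -- Without a carry in the shifted sum, `c'` would have a digit `b + e`, which is `4` or `-2`.
  · have h4 := congrFun h (p + 1 + m)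
    simp only [Nat.add_sub_cancel] at h4
    have := hb3 (p + 1 + m) (by omega)
    have := h3 (p + 1) (by omega)
    have := hc' (p + 1 + m)
    omega
  -- With a carry, the two descriptions of the tail of `v` give `f = e` and `q = p + m`. As `q > p`,
  -- the digit `c' q = b q + e` is again `4` or `-2`.
  · have h4 := (k3 (p + q + 1 + m) (by omega)).1
    have h5 := (h3 (p + q + 1) (by omega)).1
    simp only [Nat.add_sub_cancel] at h4
    have hqm : q ≤ p + m := by
      by_contra hq
      have := (h3 (q - m) (by omega)).1
      omega
    have hqp : p + m ≤ q := by
      by_contra hq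
      have := (k3 (p + m) (by omega)).1
      simp only [Nat.add_sub_cancel] at this
      omega
    have := hb3 q (by omega)
    have := hc' q
    omega

/-- The Cantor set consists of the numbers with an expansion with digits `0, 2`. -/
theorem mem_cantorSet_iff_exists_digits {x : ℝ} :
    x ∈ cantorSet ↔ ∃ c : ℕ → ℤ, c 0 = 0 ∧ (∀ n, c n = 0 ∨ c n = 2) ∧
      HasSum (fun n => (c n : ℝ) * (3 : ℝ)⁻¹ ^ n) x := by
  constructor
  · intro hx
    refine ⟨fun n => Nat.casesOn n 0 fun j => (((cantorToTernary x).get j : Fin 3) : ℕ), rfl, ?_, ?_⟩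
    · intro n
      cases n with
      | zero => simp
      | succ j =>
        have := cantorToTernary_ne_one (x := x) (n := j)
        revert this
        dsimp only
        generalize (cantorToTernary x).get j = y
        revert y
        decide
    · have h1 := (Real.summable_ofDigitsTerm (digits := (cantorToTernary x).get)).hasSum
      have h2 := ofDigits_cantorToTernary hx
      rw [Real.ofDigits] at h2
      rw [h2] at h1
      rw [← hasSum_nat_add_iff' 1]
      have e : Real.ofDigitsTerm (cantorToTernary x).get = fun j =>
          ((((cantorToTernary x).get j : Fin 3) : ℕ) : ℝ) * (3 : ℝ)⁻¹ ^ (j + 1) := by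
        ext j
        simp [Real.ofDigitsTerm]
      rw [e] at h1
      simpa using h1
  · rintro ⟨c, c0, hc, hs⟩
    have key := ofDigits_zero_two_sequence_mem_cantorSet
      (a := fun n => if c (n + 1) = 0 then 0 else 2) (fun n => by split_ifs <;> decide)
    rw [← hasSum_nat_add_iff' 1] at hs
    simp only [Finset.range_one, Finset.sum_singleton, c0, Int.cast_zero, zero_mul, sub_zero] at hs
    have h1 := (Real.summable_ofDigitsTerm
      (digits := fun n => if c (n + 1) = 0 then (0 : Fin 3) else 2)).hasSum
    have e : (fun n => (c (n + 1) : ℝ) * (3 : ℝ)⁻¹ ^ (n + 1)) =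
        Real.ofDigitsTerm fun n => if c (n + 1) = 0 then (0 : Fin 3) else 2 := by
      ext n
      rcases hc (n + 1) with h | h <;> simp [Real.ofDigitsTerm, h]
    rw [e] at hs
    rw [Real.ofDigits, h1.unique hs] at key
    exact key

/-- On the Cantor set, intrinsic ternary digits are `0` or `2`. -/
theorem intrinsicDigits_of_mem_cantorSet {x : ℝ} (hx : x ∈ cantorSet) (n : ℕ) :
    intrinsicDigits x n = 0 ∨ intrinsicDigits x n = 2 := by
  obtain ⟨c, c0, hc, hs⟩ := mem_cantorSet_iff_exists_digits.1 hx
  have h : IsIntrinsicExpansion x c :=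
    { zero := c0
      digit := fun n => by have := hc n; omega
      first_ne := fun n _ => by have := hc n; omega
      not_tail := fun n _ h => by have := hc (n + 1); have := h (n + 1) (by omega); omega
      not_tail' := fun n h => by have := hc n; omega
      sum := hs }
  rw [← h.unique (intrinsicDigits_spec (cantorSet_subset_unitInterval hx))]
  exact hc n

/-! ## Numerical semigroups -/

/-- Every residue class modulo `a` contains a sum of the `m i` when `gcd m = 1`. -/
theorem exists_list_sum_eq_of_gcd_eq_one {ι : Type*} [Fintype ι] {m : ι → ℕ}
    (hm : Finset.univ.gcd m = 1) (a : ℕ) [NeZero a] (c : ZMod a) :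
    ∃ l : List ι, (((l.map m).sum : ℕ) : ZMod a) = c := by
  classical
  obtain ⟨f, hf⟩ : ∃ f : ι → ℤ, ∑ i, (m i : ℤ) * f i = 1 := by
    obtain ⟨f, hf⟩ := Finset.gcd_eq_sum_mul (s := Finset.univ) (f := fun i => (m i : ℤ))
    refine ⟨f, ?_⟩
    rw [← hf, ← Finset.normalize_gcd, normalize_eq_one, Int.isUnit_iff_natAbs_eq, ← Nat.dvd_one,
      ← hm]
    refine Finset.dvd_gcd fun i hi => ?_
    rw [← Int.natCast_dvd_natCast, Int.natAbs_dvd]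
    exact Finset.gcd_dvd hi
  have hlist : ∀ (k : ι → ℕ) (s : Finset ι), ∃ l : List ι, (l.map m).sum = ∑ i ∈ s, m i * k i := by
    intro k s
    induction s using Finset.induction_on with
    | empty => exact ⟨[], rfl⟩
    | insert i s hi ih =>
      obtain ⟨l, hl⟩ := ih
      refine ⟨List.replicate (k i) i ++ l, ?_⟩
      rw [Finset.sum_insert hi, ← hl]
      simp [mul_comm]
  -- Bézout coefficients may be negative, but only their residues matter, so nonnegative
  -- representatives serve as multiplicities.
  obtain ⟨l, hl⟩ := hlist (fun i => ((f i : ZMod a) * c).val) Finset.univ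
  refine ⟨l, ?_⟩
  have h := congrArg (fun z : ℤ => (z : ZMod a)) hf
  rw [hl]
  push_cast at h ⊢
  simp only [ZMod.natCast_val, ZMod.cast_id', id_eq, ← mul_assoc]
  rw [← Finset.sum_mul, h, one_mul]

/-- Every residue class modulo `a ≥ 1` contains a sum of at most `a - 1` of the `m i`. -/
theorem exists_list_sum_eq {ι : Type*} [Fintype ι] {m : ι → ℕ} (hm : Finset.univ.gcd m = 1)
    (a : ℕ) [NeZero a] (c : ZMod a) :
    ∃ l : List ι, l.length < a ∧ (((l.map m).sum : ℕ) : ZMod a) = c := by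
  classical
  have hex : ∃ n, ∃ l : List ι, l.length = n ∧ (((l.map m).sum : ℕ) : ZMod a) = c := by
    obtain ⟨l, hl⟩ := exists_list_sum_eq_of_gcd_eq_one hm a c
    exact ⟨_, l, rfl, hl⟩
  obtain ⟨l, hl, hlc⟩ := Nat.find_spec hex
  refine ⟨l, ?_, hlc⟩
  by_contra hla
  -- If a shortest list had `a` or more terms, two of its prefix sums would agree modulo `a`, and
  -- the block between them could be cut out.
  have hcard : Fintype.card (ZMod a) < Fintype.card (Fin (l.length + 1)) := by
    rw [ZMod.card, Fintype.card_fin]; omega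
  obtain ⟨i, j, hij, he⟩ := Fintype.exists_ne_map_eq_of_card_lt
    (fun i : Fin (l.length + 1) => ((((l.take i).map m).sum : ℕ) : ZMod a)) hcard
  wlog hlt : i < j generalizing i j
  · exact this j i hij.symm he.symm (lt_of_le_of_ne (not_lt.1 hlt) hij.symm)
  refine Nat.find_min hex (m := (l.take i ++ l.drop j).length) ?_ ⟨_, rfl, ?_⟩
  · rw [← hl, List.length_append, List.length_take, List.length_drop]
    omega
  · rw [← hlc]
    conv_rhs => rw [← List.take_append_drop j l]
    simp only [List.map_append, List.sum_append, Nat.cast_add]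
    rw [he]

/-- The numbers from `(m i - 1) (D - 1)` on are sums of the `m j`, where `D` is an upper bound of
the `m j`; this is Schur's bound when `m i` is the least of them. -/
theorem exists_list_sum_eq_of_le {ι : Type*} [Fintype ι] {m : ι → ℕ}
    (hm : Finset.univ.gcd m = 1) {i : ι} (hi : 1 ≤ m i) {D : ℕ} (hD : ∀ j, m j ≤ D) {n : ℕ}
    (hn : (m i - 1) * (D - 1) ≤ n) : ∃ l : List ι, (l.map m).sum = n := by
  have : NeZero (m i) := ⟨by omega⟩
  obtain ⟨l, hl, hc⟩ := exists_list_sum_eq hm (m i) (n : ZMod (m i))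
  have h1 : (l.map m).sum ≤ (m i - 1) * D := by
    have h2 : (l.map m).sum ≤ (l.map m).length * D := by
      refine List.sum_le_card_nsmul _ _ fun x hx => ?_
      obtain ⟨j, -, rfl⟩ := List.mem_map.1 hx
      exact hD j
    rw [List.length_map] at h2
    exact h2.trans (Nat.mul_le_mul_right _ (by omega))
  have hD1 := hD i
  have h3 : (m i - 1) * D = (m i - 1) * (D - 1) + (m i - 1) := by
    obtain ⟨D', rfl⟩ : ∃ D', D = D' + 1 := ⟨D - 1, by omega⟩
    simp [Nat.mul_add]
  rw [ZMod.natCast_eq_natCast_iff] at hc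
  -- The sum is less than `n + m i` and congruent to `n` modulo `m i`, so it is at most `n`; copies
  -- of `i` supply the difference.
  have h4 : (l.map m).sum ≤ n := by
    by_contra hlt
    have h5 := (Nat.modEq_iff_dvd' (by omega)).1 hc.symm
    have := Nat.le_of_dvd (by omega) h5
    omega
  obtain ⟨q, hq⟩ := (Nat.modEq_iff_dvd' h4).1 hc
  refine ⟨l ++ List.replicate q i, ?_⟩
  simp only [List.map_append, List.map_replicate, List.sum_append, List.sum_replicate, smul_eq_mul]
  rw [mul_comm q]
  omega

/-- A sequence with periods `m i`, `i ∈ Z`, from `N` on has the period `gcd m`. -/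
theorem PeriodicFrom.finset_gcd {α ι : Type*} {f : ℕ → α} {N : ℕ} {m : ι → ℕ} {Z : Finset ι}
    (h : ∀ i ∈ Z, PeriodicFrom f N (m i)) : PeriodicFrom f N (Z.gcd m) := by
  have hmul : ∀ {T : ℕ}, PeriodicFrom f N T → ∀ k, PeriodicFrom f N (k * T) := by
    intro T hT k
    induction k with
    | zero => intro n _; simp
    | succ k ih =>
      intro n hn
      rw [Nat.succ_mul, ← add_assoc, hT _ (by omega), ih n hn]
  have hgcd : ∀ {S T : ℕ}, PeriodicFrom f N S → PeriodicFrom f N T →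
      PeriodicFrom f N (Nat.gcd S T) := by
    intro S T hS hT n hn
    rcases Nat.eq_zero_or_pos T with rfl | hTpos
    · rw [Nat.gcd_zero_right]; exact hS n hn
    rcases (Nat.le_of_dvd hTpos (Nat.gcd_dvd_right S T)).eq_or_lt with he | hlt
    · rw [he]; exact hT n hn
    obtain ⟨x, -, hx⟩ := Nat.exists_mul_mod_eq_gcd hlt
    -- Natural coefficients on both sides allow forward shifts only, so no argument drops below `N`.
    obtain ⟨y, hxy⟩ : ∃ y : ℕ, Nat.gcd S T + y * T = x * S :=
      ⟨S * x / T, by rw [← hx, mul_comm _ T, Nat.mod_add_div, mul_comm]⟩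
    rw [← hmul hT y (n + Nat.gcd S T) (by omega), add_assoc, hxy, hmul hS x n hn]
  classical
  induction Z using Finset.induction_on with
  | empty => intro n _; simp
  | insert i Z _ ih =>
    rw [Finset.gcd_insert]
    exact hgcd (h i (Finset.mem_insert_self _ _)) (ih fun j hj => h j (Finset.mem_insert_of_mem hj))

/-! ## Signed descents -/

/-- The states `(n, e)` reached from `(n, α n)`, `n ∈ P`, by the moves
`(n, e) ↦ (n - m i, s i * (e + u i n))`. -/
inductive Reach {ι : Type*} (m : ι → ℕ) (s : ι → ℤ) (u : ι → ℕ → ℤ) (α : ℕ → ℤ) (P : Set ℕ) :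
    ℕ → ℤ → Prop
  | start {n : ℕ} (hn : n ∈ P) : Reach m s u α P n (α n)
  | step {n : ℕ} {e : ℤ} (i : ι) (h : Reach m s u α P n e) :
      Reach m s u α P (n - m i) (s i * (e + u i n))

/-- All states reached from `P` are `1` or `-1`. -/
def ReachUnit {ι : Type*} (m : ι → ℕ) (s : ι → ℤ) (u : ι → ℕ → ℤ) (α : ℕ → ℤ) (P : Set ℕ) : Prop :=
  ∀ n e, Reach m s u α P n e → e = 1 ∨ e = -1

section

variable {ι : Type*} {m : ι → ℕ} {s : ι → ℤ} {u : ι → ℕ → ℤ} {α : ℕ → ℤ} {P : Set ℕ}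

/-- If `u i N ≠ 0`, then the states reached at `N` plus a sum of the `m j` are determined. -/
theorem ReachUnit.eq_of_reach (hs : ∀ i, s i = 1 ∨ s i = -1) (hP : IsLowerSet P)
    (H : ReachUnit m s u α P) {N : ℕ} {i : ι} (hN : u i N ≠ 0) (l : List ι)
    (hl : N + (l.map m).sum ∈ P) {e : ℤ} (hr : Reach m s u α P (N + (l.map m).sum) e) :
    e = α (N + (l.map m).sum) := by
  induction l generalizing e with
  | nil =>
    -- Adding the nonzero `u i N` to `e` or to `α N` gives `± 1` again, so both have the sign
    -- opposite to `u i N`.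
    have h0 := Reach.start (m := m) (s := s) (u := u) (α := α) hl
    have h1 := H _ _ (.step i hr)
    have h2 := H _ _ (.step i h0)
    have h3 := H _ _ hr
    have h4 := H _ _ h0
    simp only [List.map_nil, List.sum_nil, add_zero] at h1 h2 h3 h4 ⊢
    rcases hs i with h | h <;> rw [h] at h1 h2 <;> omega
  | cons j l ih =>
    rw [List.map_cons, List.sum_cons] at hl hr ⊢
    have hlow : N + (l.map m).sum ∈ P := hP (by omega) hl
    have e1 : N + (m j + (l.map m).sum) - m j = N + (l.map m).sum := by omega
    have h1 := Reach.step j hr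
    have h2 := Reach.step j (Reach.start (m := m) (s := s) (u := u) (α := α) hl)
    rw [e1] at h1 h2
    -- Moving down by `j` is injective in the state, so agreement at the lower place lifts.
    have h3 := ih hlow h1
    have h4 := ih hlow h2
    rcases hs j with h | h <;> rw [h] at h3 h4 <;> omega

/-- From `N + L` on, moves connect the states `α`, if `u i N ≠ 0` and all numbers `≥ L` are sums of
the `m j`. -/
theorem ReachUnit.step_eq (hs : ∀ i, s i = 1 ∨ s i = -1) (hP : IsLowerSet P)
    (H : ReachUnit m s u α P) {N : ℕ} {i : ι} (hN : u i N ≠ 0) {L : ℕ}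
    (hL : ∀ n ≥ L, ∃ l : List ι, (l.map m).sum = n) {q : ℕ} (hq : N + L ≤ q) {j : ι}
    (hj : q + m j ∈ P) : s j * (α (q + m j) + u j (q + m j)) = α q := by
  obtain ⟨l, hl⟩ := hL (q - N) (by omega)
  have e1 : N + (l.map m).sum = q := by omega
  have h1 := Reach.step j (Reach.start (m := m) (s := s) (u := u) (α := α) hj)
  rw [Nat.add_sub_cancel, ← e1] at h1
  have h2 := H.eq_of_reach hs hP hN l (by rw [e1]; exact hP (by omega) hj) h1
  rw [e1] at h2
  exact h2

/-- For a letter `j` in `Z` the relation of `ReachUnit.step_eq` reads `α (q + m j) = α q`. -/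
theorem ReachUnit.periodicFrom_start (hs : ∀ i, s i = 1 ∨ s i = -1)
    (H : ReachUnit m s u α Set.univ) {N : ℕ} {i : ι} (hN : u i N ≠ 0) {L : ℕ}
    (hL : ∀ n ≥ L, ∃ l : List ι, (l.map m).sum = n) {Z : Finset ι}
    (hZ : ∀ i ∈ Z, s i = 1 ∧ ∀ n, u i n = 0) : PeriodicFrom α (N + L) (Z.gcd m) := by
  refine PeriodicFrom.finset_gcd fun j hj n hn => ?_
  have := H.step_eq hs isLowerSet_univ hN hL hn (j := j) trivial
  rwa [(hZ j hj).1, (hZ j hj).2, one_mul, add_zero] at this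

/-- The relation of `ReachUnit.step_eq` expresses `u j n` through `α n` and `α (n - m j)`; the
summand `D` ensures `n - m j ≥ N + L`. -/
theorem ReachUnit.periodicFrom_column (hs : ∀ i, s i = 1 ∨ s i = -1)
    (H : ReachUnit m s u α Set.univ) {N : ℕ} {i : ι} (hN : u i N ≠ 0) {L : ℕ}
    (hL : ∀ n ≥ L, ∃ l : List ι, (l.map m).sum = n) {D : ℕ} (hD : ∀ j, m j ≤ D) {T : ℕ}
    (hT : PeriodicFrom α (N + L) T) : PeriodicFrom (fun n j => u j n) (N + L + D) T := by
  intro n hn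
  ext j
  obtain ⟨q, rfl⟩ : ∃ q, n = q + m j := ⟨n - m j, by have := hD j; omega⟩
  have hq : N + L ≤ q := by have := hD j; omega
  have h1 := H.step_eq hs isLowerSet_univ hN hL hq (j := j) trivial
  have h2 := H.step_eq hs isLowerSet_univ hN hL (q := q + T) (by omega) (j := j) trivial
  have h3 := hT q hq
  have h4 := hT (q + m j) (by omega)
  simp only
  rw [add_right_comm q (m j) T] at h4 ⊢
  rw [h3, h4] at h2
  rcases hs j with h | h <;> rw [h] at h1 h2 <;> omega

/-- Under periodicity, it is enough to start below a bound. -/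
theorem ReachUnit.of_periodicFrom (hs : ∀ i, s i = 1 ∨ s i = -1) (hα : ∀ n, α n = 1 ∨ α n = -1)
    {N L D T B : ℕ} (hN0 : 1 ≤ N) {i : ι} (hN : u i N ≠ 0)
    (hL : ∀ n ≥ L, ∃ l : List ι, (l.map m).sum = n) (hD : ∀ j, m j ≤ D) (hT : 1 ≤ T)
    (hB : N + L + D + T ≤ B)
    (hpα : PeriodicFrom α (N + L) T) (hpu : PeriodicFrom (fun n j => u j n) (N + L + D) T)
    (H : ReachUnit m s u α (Set.Iio B)) : ReachUnit m s u α Set.univ := by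
  -- If `q + m j ≥ B`, then `q ≥ N + L + T` by the choice of `B`, and lowering `q` by `T` stays in
  -- the periodic range.
  have star : ∀ q, N + L ≤ q → ∀ j, s j * (α (q + m j) + u j (q + m j)) = α q := by
    intro q
    induction q using Nat.strong_induction_on with
    | _ q ih =>
      intro hq j
      by_cases hlt : q + m j < B
      · exact H.step_eq hs (isLowerSet_Iio B) hN hL hq hlt
      · have hDj := hD j
        obtain ⟨q', rfl⟩ : ∃ q', q = q' + T := ⟨q - T, by omega⟩
        have h1 := ih q' (by omega) (by omega) j
        have h2 := hpα q' (by omega)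
        have h3 := hpα (q' + m j) (by omega)
        have h4 := congrFun (hpu (q' + m j) (by omega)) j
        simp only at h4
        rw [add_right_comm q' (m j) T] at h3 h4
        rw [h2, h3, h4, h1]
  -- From `N + L` on, every state is `α n`, hence itself a start. A move to below `N + L` from there
  -- leaves a place below `N + L + D ≤ B`, so the earlier descent can be discarded.
  have key : ∀ n e, Reach m s u α Set.univ n e →
      (N + L ≤ n → e = α n) ∧ (n < N + L → Reach m s u α (Set.Iio B) n e) := by
    intro n e hr
    induction hr with
    | @start n _ =>
      exact ⟨fun _ => rfl, fun hn => .start (show n < B by omega)⟩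
    | @step n e j _ ih =>
      by_cases hn : N + L ≤ n
      · rw [ih.1 hn]
        refine ⟨fun hj => ?_, fun hj => .step j (.start ?_)⟩
        · have := star _ hj j
          rwa [Nat.sub_add_cancel (by omega)] at this
        · have := hD j
          show n < B
          omega
      · exact ⟨fun _ => by omega, fun _ => .step j (ih.2 (by omega))⟩
  intro n e hr
  by_cases hn : N + L ≤ n
  · rw [(key n e hr).1 hn]
    exact hα n
  · exact H n e ((key n e hr).2 (by omega))

end

/-! ## Columns -/

/-- All partial sums of `e, c_1, c_2, …` are `1` or `-1`. -/
def PartialSumsUnit : ℤ → List ℤ → Prop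
  | e, [] => e = 1 ∨ e = -1
  | e, c :: l => (e = 1 ∨ e = -1) ∧ PartialSumsUnit (e + c) l

/-- The column of signed entries met on the descent from `n` along a word. -/
def descentColumn {ι : Type*} (m : ι → ℕ) (s : ι → ℤ) (u : ι → ℕ → ℤ) : List ι → ℕ → List ℤ
  | [], _ => []
  | i :: x, n => u i n :: (descentColumn m s u x (n - m i)).map (s i * ·)

namespace PartialSumsUnit

theorem head {e : ℤ} {l : List ℤ} (h : PartialSumsUnit e l) : e = 1 ∨ e = -1 := by
  cases l with
  | nil => exact h
  | cons c l => exact h.1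

theorem sum {e : ℤ} {l : List ℤ} (h : PartialSumsUnit e l) : e + l.sum = 1 ∨ e + l.sum = -1 := by
  induction l generalizing e with
  | nil => simpa [PartialSumsUnit] using h
  | cons c l ih =>
    rw [List.sum_cons, ← add_assoc]
    exact ih h.2

theorem append_singleton {e c : ℤ} {l : List ℤ} (h : PartialSumsUnit e l)
    (hc : e + l.sum + c = 1 ∨ e + l.sum + c = -1) : PartialSumsUnit e (l ++ [c]) := by
  induction l generalizing e with
  | nil => exact ⟨h, by simpa [PartialSumsUnit] using hc⟩
  | cons d l ih =>
    rw [List.sum_cons, ← add_assoc] at hc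
    exact ⟨h.1, ih h.2 hc⟩

theorem map_mul_iff {s : ℤ} (hs : s = 1 ∨ s = -1) {e : ℤ} {l : List ℤ} :
    PartialSumsUnit e (l.map (s * ·)) ↔ PartialSumsUnit (s * e) l := by
  induction l generalizing e with
  | nil => rcases hs with rfl | rfl <;> simp only [List.map_nil, PartialSumsUnit] <;> omega
  | cons c l ih =>
    have h1 : s * (e + s * c) = s * e + c := by rcases hs with rfl | rfl <;> ring
    have h2 : (e = 1 ∨ e = -1) ↔ (s * e = 1 ∨ s * e = -1) := by
      rcases hs with rfl | rfl <;> omega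
    rw [List.map_cons, PartialSumsUnit, PartialSumsUnit, ih, h1, h2]

theorem filter_iff {e : ℤ} {l : List ℤ} :
    PartialSumsUnit e (l.filter (· ≠ 0)) ↔ PartialSumsUnit e l := by
  induction l generalizing e with
  | nil => rfl
  | cons c l ih =>
    by_cases hc : c = 0
    · subst hc
      rw [List.filter_cons_of_neg (by simp), ih, PartialSumsUnit, add_zero]
      exact ⟨fun h => ⟨h.head, h⟩, fun h => h.2⟩
    · rw [List.filter_cons_of_pos (by simpa using hc), PartialSumsUnit, PartialSumsUnit, ih]

/-- Partial sums of letters `2, -2` alternate. -/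
theorem iff_isChain {e : ℤ} (he : e = 1 ∨ e = -1) {l : List ℤ} (hl : ∀ c ∈ l, c = 2 ∨ c = -2) :
    PartialSumsUnit e l ↔
      (l.IsChain fun b c => ¬ (b = 2 ∧ c = 2) ∧ ¬ (b = -2 ∧ c = -2)) ∧
        (l.head? = some 2 → e = -1) ∧ (l.head? = some (-2) → e = 1) := by
  induction l generalizing e with
  | nil => simp [PartialSumsUnit, he]
  | cons c l ih =>
    have hc := hl c (by simp)
    have hl' : ∀ c ∈ l, c = 2 ∨ c = -2 := fun d hd => hl d (by simp [hd])
    rw [PartialSumsUnit, List.head?_cons, Option.some_inj, Option.some_inj]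
    constructor
    · rintro ⟨-, h⟩
      have h0 := h.head
      obtain ⟨h1, h2, h3⟩ := (ih h0 hl').1 h
      refine ⟨?_, by omega, by omega⟩
      cases l with
      | nil => simp
      | cons d l =>
        rw [List.isChain_cons_cons]
        refine ⟨?_, h1⟩
        have := hl' d (by simp)
        simp only [List.head?_cons, Option.some_inj] at h2 h3
        omega
    · rintro ⟨h1, h2, h3⟩
      have h0 : e + c = 1 ∨ e + c = -1 := by omega
      refine ⟨he, (ih h0 hl').2 ⟨h1.tail, ?_⟩⟩
      cases l with
      | nil => simp
      | cons d l =>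
        rw [List.isChain_cons_cons] at h1
        simp only [List.head?_cons, Option.some_inj]
        omega

end PartialSumsUnit

section

variable {ι : Type*} {m : ι → ℕ} {s : ι → ℤ} {u : ι → ℕ → ℤ} {α : ℕ → ℤ} {P : Set ℕ}

theorem descentColumn_append_singleton (x : List ι) (i : ι) (n : ℕ) :
    descentColumn m s u (x ++ [i]) n =
      descentColumn m s u x n ++ [(x.map s).prod * u i (n - (x.map m).sum)] := by
  induction x generalizing n with
  | nil => simp [descentColumn]
  | cons j x ih => simp [descentColumn, ih, mul_assoc, Nat.sub_sub]

theorem partialSumsUnit_cons_iff (hs : ∀ i, s i = 1 ∨ s i = -1) {i : ι} {x : List ι} {n : ℕ} {e : ℤ} :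
    PartialSumsUnit e (descentColumn m s u (i :: x) n) ↔
      (e = 1 ∨ e = -1) ∧ PartialSumsUnit (s i * (e + u i n)) (descentColumn m s u x (n - m i)) := by
  rw [descentColumn, PartialSumsUnit, PartialSumsUnit.map_mul_iff (hs i)]

/-- A state is a partial sum of the column times the product of the signs so far, and this factor
does not affect being `± 1`. -/
theorem reachUnit_iff (hs : ∀ i, s i = 1 ∨ s i = -1) :
    ReachUnit m s u α P ↔ ∀ p ∈ P, ∀ x, PartialSumsUnit (α p) (descentColumn m s u x p) := by
  constructor
  · intro H p hp x
    have key : ∀ (x : List ι) n e, Reach m s u α P n e →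
        PartialSumsUnit e (descentColumn m s u x n) := by
      intro x
      induction x with
      | nil => exact H
      | cons i x ih =>
        intro n e hr
        exact (partialSumsUnit_cons_iff hs).2 ⟨H n e hr, ih _ _ (.step i hr)⟩
    exact key x p _ (.start hp)
  · intro H n e hr
    -- Induction along `Reach` needs the condition for all continuations of the descent.
    have key : ∀ x, PartialSumsUnit e (descentColumn m s u x n) := by
      induction hr with
      | start hn => exact H _ hn
      | step i _ ih => exact fun x => ((partialSumsUnit_cons_iff hs).1 (ih (i :: x))).2
    exact key []

/-- Rows which start below `N`, the first place where `u` does not vanish, do not matter. -/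
theorem partialSumsUnit_of_length_le (hs : ∀ i, s i = 1 ∨ s i = -1) (hm : ∀ i, 1 ≤ m i) {N : ℕ}
    (hN : 1 ≤ N) (hu : ∀ n < N, ∀ i, u i n = 0) {n : ℕ} {e : ℤ} (x : List ι)
    (h : ∀ y : List ι, y.length ≤ n + 1 - N → PartialSumsUnit e (descentColumn m s u y n)) :
    PartialSumsUnit e (descentColumn m s u x n) := by
  induction x generalizing n e with
  | nil => exact h [] (by simp)
  | cons i x ih =>
    have h0 : e = 1 ∨ e = -1 := h [] (by simp)
    refine (partialSumsUnit_cons_iff hs).2 ⟨h0, ih fun y hy => ?_⟩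
    have := hm i
    -- Below `N` only the empty word is available, and the entry is zero. Otherwise `n ≥ N ≥ 1`, so
    -- the truncated `n - m i` really is smaller than `n` and the length bound drops.
    by_cases hn : n < N
    · rw [List.eq_nil_of_length_eq_zero (l := y) (by omega), hu n hn i]
      change s i * (e + 0) = 1 ∨ s i * (e + 0) = -1
      rcases hs i with h | h <;> rw [h] <;> omega
    · exact ((partialSumsUnit_cons_iff hs).1 (h (i :: y) (by rw [List.length_cons]; omega))).2

/-- When `r` divides all `m i`, descents stay in the residue classes modulo `r`. -/
theorem descentColumn_div {r : ℕ} (hr : ∀ i, r ∣ m i) (c : ℕ) (x : List ι) (n : ℕ) :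
    descentColumn (fun i => m i / r) s (fun i n => u i (r * n - c)) x n =
      descentColumn m s u x (r * n - c) := by
  induction x generalizing n with
  | nil => rfl
  | cons i x ih =>
    rw [descentColumn, descentColumn, ih, Nat.mul_sub, Nat.mul_div_cancel' (hr i), Nat.sub_right_comm]

theorem reachUnit_univ_iff_forall_residue (hs : ∀ i, s i = 1 ∨ s i = -1) {r : ℕ} (hr0 : 1 ≤ r)
    (hr : ∀ i, r ∣ m i) :
    ReachUnit m s u α Set.univ ↔ ∀ c < r, ReachUnit (fun i => m i / r) s
      (fun i n => u i (r * n - c)) (fun n => α (r * n - c)) Set.univ := by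
  simp only [reachUnit_iff hs, descentColumn_div hr, Set.mem_univ, true_imp_iff]
  refine ⟨fun H c _ n => H _, fun H p x => ?_⟩
  -- The witness is `n = ⌈p / r⌉` with `c = r * n - p`; for `p = 0` both are `0`.
  have h1 := Nat.mod_lt (r - 1 + p) hr0
  have h2 := Nat.div_add_mod (r - 1 + p) r
  have h3 := H (r - 1 - (r - 1 + p) % r) (by omega) ((r - 1 + p) / r) x
  rwa [show r * ((r - 1 + p) / r) - (r - 1 - (r - 1 + p) % r) = p by omega] at h3

end

/-! ### Matching in terms of partial sums -/

namespace TernaryIFS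

variable {k : ℕ} (Φ : TernaryIFS k)

theorem U_spec (i : Fin k) : IsIntrinsicExpansion (Φ.d i) (Φ.U i) :=
  intrinsicDigits_spec (Φ.d_mem i)

theorem U_eq_zero {i : Fin k} (hi : Φ.d i = 0) (n : ℕ) : Φ.U i n = 0 := by
  have h : IsIntrinsicExpansion (Φ.d i) 0 := by
    rw [hi]
    constructor <;> simp [hasSum_zero]
  rw [(Φ.U_spec i).unique h]
  rfl

theorem ofFn_V (x : List (Fin k)) (p : ℕ) :
    (List.ofFn fun j => Φ.V x j p) = descentColumn Φ.m Φ.s Φ.U x p := by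
  -- Truncated subtraction sends places before the start of a row to the digit `U i 0 = 0`, so no
  -- case distinction is needed.
  have hV : ∀ (x : List (Fin k)) (j : Fin x.length) (p : ℕ), Φ.V x j p =
      ((x.take j).map Φ.s).prod * Φ.U (x.get j) (p - ((x.take j).map Φ.m).sum) := by
    intro x j p
    rw [V]
    split_ifs with h
    · rw [Nat.sub_eq_zero_of_le h, (Φ.U_spec _).zero, mul_zero]
    · rfl
  simp only [hV]
  induction x generalizing p with
  | nil => rfl
  | cons i x ih =>
    rw [descentColumn, ← ih, List.map_ofFn]
    simp [List.ofFn_succ, Function.comp_def, mul_assoc, Nat.sub_sub]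

/-- The starting value is `-1` for `a p = 0` and `1` for `a p = 2`. Zeros repeat a partial sum, and
letters `± 2` keep it at `± 1` exactly when they alternate and start with the right sign. -/
theorem matching_iff {a : ℕ → ℤ} (ha : ∀ n, a n = 0 ∨ a n = 2) (x : List (Fin k)) (p : ℕ) :
    Φ.Matching a x p ↔ PartialSumsUnit (a p - 1) (descentColumn Φ.m Φ.s Φ.U x p) := by
  have hap := ha p
  have hV : ∀ c ∈ descentColumn Φ.m Φ.s Φ.U x p, c = 0 ∨ c = 2 ∨ c = -2 := by
    induction x generalizing p with
    | nil => simp [descentColumn]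
    | cons i x ih =>
      intro c hc
      rcases List.mem_cons.1 hc with rfl | hc
      · exact (Φ.U_spec i).digit p
      · obtain ⟨d, hd, rfl⟩ := List.mem_map.1 hc
        have := ih _ (ha _) d hd
        rcases Φ.sign i with h | h <;> simp only [h] <;> omega
  have hred : Φ.reducedColumn x p = (descentColumn Φ.m Φ.s Φ.U x p).filter (· ≠ 0) := by
    rw [reducedColumn, ofFn_V]
  rw [← PartialSumsUnit.filter_iff, ← hred, PartialSumsUnit.iff_isChain (by omega)]
  · constructor
    · rintro ⟨h1, h2, h3⟩
      exact ⟨h1, fun h => by have := h2 h; omega, fun h => by have := h3 h; omega⟩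
    · rintro ⟨h1, h2, h3⟩
      exact ⟨h1, fun h => by have := h2 h; omega, fun h => by have := h3 h; omega⟩
  · intro c hc
    rw [hred, List.mem_filter] at hc
    have := hV c hc.1
    simp only [ne_eq, decide_eq_true_eq] at hc
    omega

/-! ### Points of the attractor and addition without carries -/

/-- The point `φ_{x_1} ∘ ⋯ ∘ φ_{x_t} (0)`. -/
noncomputable def point (x : List (Fin k)) : ℝ := x.foldr Φ.map 0

theorem point_append (x y : List (Fin k)) : Φ.point (x ++ y) =
    Φ.point x + (x.map Φ.s).prod * (3 : ℝ)⁻¹ ^ (x.map Φ.m).sum * Φ.point y := by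
  induction x with
  | nil => simp [point]
  | cons i x ih =>
    simp only [point, List.cons_append, List.foldr_cons] at ih ⊢
    rw [ih]
    simp only [map, List.map_cons, List.prod_cons, List.sum_cons, pow_add]
    push_cast
    ring

theorem hasSum_shift {v : ℕ → ℤ} {y : ℝ} (hv : v 0 = 0)
    (h : HasSum (fun n => (v n : ℝ) * (3 : ℝ)⁻¹ ^ n) y) (m : ℕ) :
    HasSum (fun n => (v (n - m) : ℝ) * (3 : ℝ)⁻¹ ^ n) ((3 : ℝ)⁻¹ ^ m * y) := by
  rw [← hasSum_nat_add_iff' m, Finset.sum_eq_zero, sub_zero]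
  · have := h.mul_left ((3 : ℝ)⁻¹ ^ m)
    have e : (fun n => (v (n + m - m) : ℝ) * (3 : ℝ)⁻¹ ^ (n + m)) =
        fun n => (3 : ℝ)⁻¹ ^ m * ((v n : ℝ) * (3 : ℝ)⁻¹ ^ n) := by
      ext n
      rw [Nat.add_sub_cancel, pow_add]
      ring
    rwa [e]
  · intro n hn
    rw [Nat.sub_eq_zero_of_le (Finset.mem_range.1 hn).le, hv]
    simp

theorem descentColumn_zero (x : List (Fin k)) : (descentColumn Φ.m Φ.s Φ.U x 0).sum = 0 := by
  induction x with
  | nil => rfl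
  | cons i x ih =>
    rw [descentColumn, List.sum_cons, List.sum_map_mul_left, List.map_id', Nat.zero_sub, ih,
      (Φ.U_spec i).zero]
    simp

/-- The column sums are only formal digits: nothing bounds them before matching is known. -/
theorem hasSum_point (x : List (Fin k)) :
    HasSum (fun n => ((descentColumn Φ.m Φ.s Φ.U x n).sum : ℝ) * (3 : ℝ)⁻¹ ^ n) (Φ.point x) := by
  induction x with
  | nil => simp [descentColumn, point, hasSum_zero]
  | cons i x ih =>
    have h1 := (hasSum_shift (Φ.descentColumn_zero x) ih (Φ.m i)).mul_left (Φ.s i : ℝ)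
    have h2 := (Φ.U_spec i).sum.add h1
    have e1 : Φ.point (i :: x) = Φ.d i + Φ.s i * ((3 : ℝ)⁻¹ ^ Φ.m i * Φ.point x) := by
      simp only [point, List.foldr_cons, map]
      ring
    rw [e1]
    refine h2.congr_fun fun n => ?_
    rw [descentColumn, List.sum_cons, List.sum_map_mul_left, List.map_id']
    push_cast
    ring

theorem map_mem_attractor (i : Fin k) {y : ℝ} (hy : y ∈ Φ.attractor) :
    Φ.map i y ∈ Φ.attractor := by
  rw [Φ.isAttractor_attractor.eq_iUnion]
  exact Set.mem_iUnion.2 ⟨i, y, hy, rfl⟩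

theorem point_mem_attractor (x : List (Fin k)) : Φ.point x ∈ Φ.attractor := by
  induction x with
  | cons i x ih => exact Φ.map_mem_attractor i ih
  | nil =>
    obtain ⟨y, hy⟩ := Φ.isAttractor_attractor.nonempty
    -- The fixed point `0` of the first map is the limit of its iterates at any point of the
    -- attractor.
    let i₀ : Fin k := ⟨0, by have := Φ.two_le; omega⟩
    have h1 : ∀ n : ℕ, ((3 : ℝ)⁻¹ ^ Φ.m i₀) ^ n * y ∈ Φ.attractor := by
      intro n
      induction n with
      | zero => simpa using hy
      | succ n ih =>
        have := Φ.map_mem_attractor i₀ ih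
        rw [map, Φ.s_first, Φ.d_first] at this
        rw [pow_succ']
        simpa [mul_assoc] using this
    refine Φ.isAttractor_attractor.isCompact.isClosed.mem_of_tendsto ?_
      (Filter.Eventually.of_forall h1 : ∀ᶠ n in Filter.atTop, _)
    have h2 : (3 : ℝ)⁻¹ ^ Φ.m i₀ < 1 :=
      pow_lt_one₀ (by norm_num) (by norm_num) (by have := Φ.one_le_m i₀; omega)
    simpa [point] using (tendsto_pow_atTop_nhds_zero_of_lt_one (by positivity) h2).mul_const y

theorem attractor_subset_closure : Φ.attractor ⊆ closure (Set.range Φ.point) := by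
  obtain ⟨R, hR⟩ := Φ.isAttractor_attractor.isCompact.isBounded.exists_norm_le
  have key : ∀ n : ℕ, ∀ y ∈ Φ.attractor, ∃ x, |y - Φ.point x| ≤ (3 : ℝ)⁻¹ ^ n * R := by
    intro n
    induction n with
    | zero => exact fun y hy => ⟨[], by simpa [point] using hR y hy⟩
    | succ n ih =>
      intro y hy
      rw [Φ.isAttractor_attractor.eq_iUnion] at hy
      obtain ⟨i, y', hy', rfl⟩ := Set.mem_iUnion.1 hy
      obtain ⟨x, hx⟩ := ih y' hy'
      refine ⟨i :: x, (Φ.dist_map_le i y' (Φ.point x)).trans ?_⟩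
      rw [pow_succ]
      linarith
  intro y hy
  rw [Metric.mem_closure_iff]
  intro ε hε
  have ht : Filter.Tendsto (fun n : ℕ => (3 : ℝ)⁻¹ ^ n * R) Filter.atTop (nhds 0) := by
    simpa using (tendsto_pow_atTop_nhds_zero_of_lt_one (r := (3 : ℝ)⁻¹)
      (by norm_num) (by norm_num)).mul_const R
  obtain ⟨n, hn⟩ := (ht.eventually_lt_const hε).exists
  obtain ⟨x, hx⟩ := key n y hy
  exact ⟨_, ⟨x, rfl⟩, by rw [Real.dist_eq]; exact hx.trans_lt hn⟩

/-- The translate `a + F` lies in the Cantor set if and only if all words match `a` in all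
columns. -/
theorem image_attractor_subset_iff {a : ℝ} (ha : a ∈ cantorSet) :
    (fun x => a + x) '' Φ.attractor ⊆ cantorSet ↔ ∀ p x,
      PartialSumsUnit (intrinsicDigits a p - 1) (descentColumn Φ.m Φ.s Φ.U x p) := by
  have had := intrinsicDigits_of_mem_cantorSet ha
  have has := intrinsicDigits_spec (cantorSet_subset_unitInterval ha)
  have hsum : ∀ x, HasSum (fun n => ((intrinsicDigits a n +
      (descentColumn Φ.m Φ.s Φ.U x n).sum : ℤ) : ℝ) * (3 : ℝ)⁻¹ ^ n) (a + Φ.point x) := by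
    intro x
    have := has.sum.add (Φ.hasSum_point x)
    simpa only [Int.cast_add, add_mul] using this
  constructor
  · intro H
    have hC : ∀ x, a + Φ.point x ∈ cantorSet := fun x => H ⟨_, Φ.point_mem_attractor x, rfl⟩
    suffices h : ∀ x p, PartialSumsUnit (intrinsicDigits a p - 1)
        (descentColumn Φ.m Φ.s Φ.U x p) from fun p x => h x p
    intro x
    induction x using List.reverseRecOn with
    | nil =>
      intro p
      have := had p
      change _ = _ ∨ _ = _
      omega
    | append_singleton x i ih =>
      intro p
      rw [descentColumn_append_singleton]
      refine (ih p).append_singleton ?_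
      let i₀ : Fin k := ⟨0, by have := Φ.two_le; omega⟩
      obtain ⟨c, -, hc, sc⟩ := mem_cantorSet_iff_exists_digits.1 (hC (x ++ [i]))
      -- Inserting `i₀` delays the row of `i` by `m i₀` places without changing its sign; this
      -- second point excludes carries at the first.
      obtain ⟨c', -, hc', sc'⟩ := mem_cantorSet_iff_exists_digits.1 (hC (x ++ [i₀, i]))
      have hS : (x.map Φ.s).prod = 1 ∨ (x.map Φ.s).prod = -1 := by
        clear ih sc sc'
        induction x with
        | nil => exact Or.inl rfl
        | cons j x ih =>
          rw [List.map_cons, List.prod_cons]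
          rcases Φ.sign j with h | h <;> rw [h] <;> omega
      have hpi : Φ.point [i] = Φ.d i := by simp [point, map]
      have hpi' : Φ.point [i₀, i] = (3 : ℝ)⁻¹ ^ Φ.m i₀ * Φ.d i := by
        simp only [point, List.foldr_cons, List.foldr_nil, map]
        rw [Φ.s_first, Φ.d_first]
        simp
      have hu0 := (Φ.U_spec i).zero
      have hsv : ∀ M, HasSum (fun n => (((x.map Φ.s).prod * Φ.U i (n - M) : ℤ) : ℝ) * (3 : ℝ)⁻¹ ^ n)
          ((x.map Φ.s).prod * ((3 : ℝ)⁻¹ ^ M * Φ.d i)) := by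
        intro M
        have := (hasSum_shift hu0 (Φ.U_spec i).sum M).mul_left ((x.map Φ.s).prod : ℝ)
        simpa only [Int.cast_mul, mul_assoc] using this
      rw [point_append, hpi, ← add_assoc] at sc
      rw [point_append, hpi', ← add_assoc] at sc'
      generalize (x.map Φ.s).prod = S at hS hsv sc sc' ⊢
      generalize (x.map Φ.m).sum = M at sc sc' ⊢
      have hdig := (Φ.U_spec i).digit
      have htail : ∀ e : ℤ, e = 2 ∨ e = -2 → ∀ n, S * Φ.U i (n - M) = e →
          ¬ ∀ j > n, S * Φ.U i (j - M) = -e := by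
        intro e he n hn hj
        have hj' : ∀ j > n - M, S * Φ.U i j = -e := fun j hjn => by
          have := hj (j + M) (by omega)
          rwa [Nat.add_sub_cancel] at this
        have t1 := (Φ.U_spec i).not_tail (n - M)
        have t2 := (Φ.U_spec i).not_tail' (n - M)
        rcases hS with rfl | rfl <;> rcases he with rfl | rfl
        · exact t1 (by omega) fun j hjn => by have := hj' j hjn; omega
        · exact t2 (by omega) fun j hjn => by have := hj' j hjn; omega
        · exact t2 (by omega) fun j hjn => by have := hj' j hjn; omega
        · exact t1 (by omega) fun j hjn => by have := hj' j hjn; omega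
      have key := add_digits_of_shift (Φ.one_le_m i₀)
        (b := fun n => intrinsicDigits a n + (descentColumn Φ.m Φ.s Φ.U x n).sum)
        (v := fun n => S * Φ.U i (n - M)) (c := c) (c' := c')
        (y := S * ((3 : ℝ)⁻¹ ^ M * Φ.d i))
        (fun n => by have := (ih n).sum; omega) hc hc'
        (fun n => by have := hdig (n - M); rcases hS with rfl | rfl <;> omega)
        (fun n => htail 2 (Or.inl rfl) n) (fun n => htail (-2) (Or.inr rfl) n)
        (hsum x) (hsv M)
        (by rw [← mul_assoc]; exact sc)
        (by
          have := hsv (Φ.m i₀ + M)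
          simp only [← Nat.sub_sub] at this
          convert this using 1
          rw [pow_add]
          ring)
        (by
          convert sc' using 1
          ring) p
      have := hc p
      omega
  · intro H
    have hC : ∀ x, a + Φ.point x ∈ cantorSet := by
      intro x
      refine mem_cantorSet_iff_exists_digits.2 ⟨_, ?_, fun n => ?_, hsum x⟩
      · rw [has.zero, Φ.descentColumn_zero, add_zero]
      · have := (H n x).sum
        omega
    rintro _ ⟨y, hy, rfl⟩
    have hcl : IsClosed ((fun x => a + x) ⁻¹' cantorSet) :=
      isClosed_cantorSet.preimage (by fun_prop)
    exact closure_minimal (by rintro _ ⟨x, rfl⟩; exact hC x) hcl (Φ.attractor_subset_closure hy)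

/-! ### Thresholds, parameters and a single residue class -/

/-- A finite infimum in `ℕ∞` is attained, so quantifying over natural `N` equal to the threshold
encodes `n_i ≠ ∞`. -/
theorem threshold_eq_iff {i N : ℕ} : Φ.threshold i = (N : ℕ∞) ↔
    IsLeast {n : ℕ | 1 ≤ n ∧ Φ.column (Φ.r * n - i) ≠ 0} N := by
  have h1 : ∀ {M : ℕ}, IsLeast {n : ℕ | 1 ≤ n ∧ Φ.column (Φ.r * n - i) ≠ 0} M →
      Φ.threshold i = (M : ℕ∞) := fun h =>
    le_antisymm (iInf₂_le _ h.1) (le_iInf₂ fun n hn => Nat.cast_le.2 (h.2 hn))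
  refine ⟨fun h => ?_, h1⟩
  rcases Set.eq_empty_or_nonempty {n : ℕ | 1 ≤ n ∧ Φ.column (Φ.r * n - i) ≠ 0} with he | hne
  · rw [threshold, he] at h
    simp at h
  · have hl : IsLeast {n : ℕ | 1 ≤ n ∧ Φ.column (Φ.r * n - i) ≠ 0} _ :=
      ⟨Nat.sInf_mem hne, fun _ hn => Nat.sInf_le hn⟩
    rw [h1 hl, Nat.cast_inj] at h
    rwa [h] at hl

theorem finite_testPairs (N : ℕ) : (Φ.testPairs N).Finite := by
  set B := N + Φ.L + Φ.D / Φ.r + 2 * Φ.ell * Φ.D / Φ.r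
  refine ((Set.finite_Iio B).prod (List.finite_length_le (Fin k) (B + 1))).subset ?_
  rintro ⟨p, x⟩ ⟨h1, h2, -, h3⟩
  refine ⟨h2, ?_⟩
  change x.length ≤ B + 1
  simp only at h1 h2 h3
  omega

theorem r_dvd (i : Fin k) : Φ.r ∣ Φ.m i := Finset.gcd_dvd (Finset.mem_univ i)

theorem one_le_m_div (hr : 1 ≤ Φ.r) (i : Fin k) : 1 ≤ Φ.m i / Φ.r :=
  Nat.div_pos (Nat.le_of_dvd (Φ.one_le_m i) (Φ.r_dvd i)) hr

theorem gcd_m_div (hr : 1 ≤ Φ.r) (Z : Finset (Fin k)) : Z.gcd (fun i => Φ.m i / Φ.r) = Z.gcd Φ.m / Φ.r := by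
  refine (Nat.div_eq_of_eq_mul_right hr ?_).symm
  have := Finset.gcd_mul_left (s := Z) (f := fun i => Φ.m i / Φ.r) (a := Φ.r)
  rw [normalize_eq] at this
  rw [← this]
  exact Finset.gcd_congr rfl fun i _ => (Nat.mul_div_cancel' (Φ.r_dvd i)).symm

theorem m_div_le (i : Fin k) : Φ.m i / Φ.r ≤ Φ.D / Φ.r :=
  Nat.div_le_div_right (Finset.le_sup (f := Φ.m) (Finset.mem_univ i))

theorem exists_list_sum_eq_of_L_le (hr : 1 ≤ Φ.r) (n : ℕ) (hn : Φ.L ≤ n) :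
    ∃ l : List (Fin k), (l.map fun i => Φ.m i / Φ.r).sum = n := by
  have : Nonempty (Fin k) := ⟨⟨0, by have := Φ.two_le; omega⟩⟩
  -- An index attaining `minM` makes the bound of `exists_list_sum_eq_of_le` equal to `L`.
  obtain ⟨i, hi⟩ := Nat.sInf_mem (Set.range_nonempty Φ.m)
  refine exists_list_sum_eq_of_le (m := fun i => Φ.m i / Φ.r) ?_ (Φ.one_le_m_div hr i) Φ.m_div_le (n := n) ?_
  · rw [Φ.gcd_m_div hr]
    exact Nat.div_self hr
  · rw [hi]
    exact hn

/-- The characterization for a single residue class modulo `r`. -/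
theorem reachUnit_residue_iff (hr : 1 ≤ Φ.r) {a : ℕ → ℤ} (ha : ∀ n, a n = 0 ∨ a n = 2) (c : ℕ) :
    ReachUnit (fun i => Φ.m i / Φ.r) Φ.s (fun i n => Φ.U i (Φ.r * n - c))
        (fun n => a (Φ.r * n - c) - 1) Set.univ ↔
      ∀ N : ℕ, Φ.threshold c = (N : ℕ∞) →
        PeriodicFrom (fun n => Φ.column (Φ.r * n - c)) (N + Φ.L + Φ.D / Φ.r) (Φ.ell / Φ.r) ∧
        PeriodicFrom (fun n => a (Φ.r * n - c)) (N + Φ.L) (Φ.ell / Φ.r) ∧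
        ∀ p x, (p, x) ∈ Φ.testPairs N → Φ.Matching a x (Φ.r * p - c) := by
  classical
  have hs := Φ.sign
  have hL := Φ.exists_list_sum_eq_of_L_le hr
  have hα : ∀ n, a (Φ.r * n - c) - 1 = 1 ∨ a (Φ.r * n - c) - 1 = -1 := fun n => by
    have := ha (Φ.r * n - c); omega
  have hell : Φ.ell / Φ.r =
      (Finset.univ.filter fun i => Φ.d i = 0).gcd fun i => Φ.m i / Φ.r := by
    rw [Φ.gcd_m_div hr, ell]
  simp only [Φ.matching_iff ha, threshold_eq_iff]
  constructor
  · rintro H N ⟨⟨hN1, hN⟩, -⟩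
    obtain ⟨i, hi⟩ := Function.ne_iff.1 hN
    have hp := H.periodicFrom_start hs (i := i) hi hL
      (Z := Finset.univ.filter fun i => Φ.d i = 0) fun j hj => by
        have hj := (Finset.mem_filter.1 hj).2
        refine ⟨(hs j).resolve_right fun h => (Φ.d_pos_of_neg j h).ne' hj, fun n => ?_⟩
        exact Φ.U_eq_zero hj _
    rw [← hell] at hp
    refine ⟨H.periodicFrom_column hs (i := i) hi hL Φ.m_div_le hp, fun n hn => ?_, ?_⟩
    · have := hp n hn
      simpa using this
    · intro p x _
      rw [← descentColumn_div Φ.r_dvd]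
      exact (reachUnit_iff hs).1 H p trivial x
  · intro H
    by_cases hne : ∃ n, 1 ≤ n ∧ Φ.column (Φ.r * n - c) ≠ 0
    · have hl : IsLeast {n : ℕ | 1 ≤ n ∧ Φ.column (Φ.r * n - c) ≠ 0} _ :=
        ⟨Nat.sInf_mem hne, fun _ hn => Nat.sInf_le hn⟩
      generalize sInf {n : ℕ | 1 ≤ n ∧ Φ.column (Φ.r * n - c) ≠ 0} = N at hl
      obtain ⟨hpu, hpa, hM⟩ := H N hl
      obtain ⟨i, hi⟩ := Function.ne_iff.1 hl.1.2
      have hu : ∀ n < N, ∀ j, Φ.U j (Φ.r * n - c) = 0 := by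
        intro n hn j
        rcases Nat.eq_zero_or_pos n with rfl | hn0
        · rw [mul_zero, Nat.zero_sub]
          exact (Φ.U_spec j).zero
        · by_contra hj
          have := hl.2 (show n ∈ _ from ⟨hn0, fun h => hj (congrFun h j)⟩)
          omega
      have hT : 1 ≤ Φ.ell / Φ.r := by
        rw [hell, Nat.one_le_iff_ne_zero, Ne, Finset.gcd_eq_zero_iff]
        intro h
        have h1 := Φ.one_le_m_div hr ⟨0, by have := Φ.two_le; omega⟩
        have h2 := h ⟨0, by have := Φ.two_le; omega⟩ (by simp [Φ.d_first])
        omega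
      -- One period beyond `N + L + D / r` suffices, and the test range contains it.
      have hB : Φ.ell / Φ.r ≤ 2 * Φ.ell * Φ.D / Φ.r := by
        refine Nat.div_le_div_right ?_
        have h1 := Φ.one_le_m i
        have h2 : Φ.m i ≤ Φ.D := Finset.le_sup (f := Φ.m) (Finset.mem_univ i)
        nlinarith
      refine ReachUnit.of_periodicFrom (B := N + Φ.L + Φ.D / Φ.r + 2 * Φ.ell * Φ.D / Φ.r) hs hα
        hl.1.1 (i := i) hi hL Φ.m_div_le hT (by omega)
        (fun n hn => by have := hpa n hn; simp only at this ⊢; rw [this]) hpu ?_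
      refine (reachUnit_iff hs).2 fun p hp x => ?_
      refine partialSumsUnit_of_length_le hs (Φ.one_le_m_div hr) hl.1.1 hu x fun y hy => ?_
      -- Test pairs contain no empty word; for it the condition is just that `α p` is `± 1`.
      cases y with
      | nil => exact hα p
      | cons j y =>
        rw [descentColumn_div Φ.r_dvd]
        rw [List.length_cons] at hy
        refine hM p _ ⟨by simp only; omega, hp, by simp, ?_⟩
        simp only [List.length_cons]
        omega
    -- For an infinite threshold all entries in the class vanish, so moves only multiply the state
    -- by signs.
    · have hu : ∀ n j, Φ.U j (Φ.r * n - c) = 0 := by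
        intro n j
        rcases Nat.eq_zero_or_pos n with rfl | hn0
        · rw [mul_zero, Nat.zero_sub]
          exact (Φ.U_spec j).zero
        · by_contra hj
          exact hne ⟨n, hn0, fun h => hj (congrFun h j)⟩
      intro n e h
      induction h with
      | start _ => exact hα _
      | step j _ ih =>
        rw [hu, add_zero]
        rcases hs j with h | h <;> rw [h] <;> omega

end TernaryIFS

theorem mainTheorem6 {k : ℕ} (Φ : TernaryIFS k) (a : ℝ) (ha : a ∈ cantorSet) (hr : 1 < Φ.r) :
    ((fun x => a + x) '' Φ.attractor ⊆ cantorSet ↔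
      ∀ i < Φ.r, ∀ N : ℕ, Φ.threshold i = (N : ℕ∞) →
        PeriodicFrom (fun n => Φ.column (Φ.r * n - i)) (N + Φ.L + Φ.D / Φ.r) (Φ.ell / Φ.r) ∧
        PeriodicFrom (fun n => intrinsicDigits a (Φ.r * n - i)) (N + Φ.L) (Φ.ell / Φ.r) ∧
        ∀ p x, (p, x) ∈ Φ.testPairs N → Φ.Matching (intrinsicDigits a) x (Φ.r * p - i)) ∧
    ∀ N : ℕ, (Φ.testPairs N).Finite := by
  refine ⟨?_, Φ.finite_testPairs⟩
  have had := intrinsicDigits_of_mem_cantorSet ha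
  have h1 := reachUnit_iff (m := Φ.m) (s := Φ.s) (u := Φ.U) (P := Set.univ)
    (α := fun n => intrinsicDigits a n - 1) Φ.sign
  simp only [Set.mem_univ, true_imp_iff] at h1
  rw [Φ.image_attractor_subset_iff ha, ← h1,
    reachUnit_univ_iff_forall_residue Φ.sign hr.le Φ.r_dvd]
  exact forall₂_congr fun i _ => Φ.reachUnit_residue_iff hr.le had i
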